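/- Let $A$ be an associative ring with unit and $\mathfrak C$ an $A$-coring, i.e. an $A$-bimodule with a coassociative comultiplication $\Delta(c)=c_{(1)}\otimes_A c_{(2)}$ and a counit $\varepsilon$, both $A$-bilinear. Its left dual ${}^*\mathfrak C={}_A\mathrm{Hom}(\mathfrak C,A)$ is a ring with product $(f*g)(c)=g(c_{(1)}f(c_{(2)}))$ and a right $A$-module via $(fa)(c)=f(c)a$. Every right $\mathfrak C$-comodule $M$ with coaction $m\mapsto m_{[0]}\otimes_A m_{[1]}$ is a right ${}^*\mathfrak C$-module via $m\cdot f=m_{[0]}f(m_{[1]})$. Let $\mathrm{Rat}({}^*\mathfrak C)$ be the largest right $A$-submodule $N$ of ${}^*\mathfrak C$ having a right $\mathfrak C$-comodule structure such that $n*f=n_{[0]}f(n_{[1]})$ for all $n\in N$, $f\in{}^*\mathfrak C$. An object $X$ of a Grothendieck category is called weakly locally projective if for every monomorphism $i:E\to X$ with $E$ finitely generated, every epimorphism $g:M\to N$ and every $f:X\to N$ there is $h:X\to M$ with $g\circ h\circ i=f\circ i$; here $E$ is finitely generated if, whenever it is the sum of a directed family of subobjects, it equals one of them. Suppose that $\mathfrak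 C$ is weakly locally projective as a left $A$-module and that $\mathrm{Rat}({}^*\mathfrak C)$ is dense in ${}^*\mathfrak C$ for the finite topology (the topology of pointwise convergence, with $A$ discrete). Let $\Sigma$ be a right $\mathfrak C$-comodule, $T=\mathrm{End}^{\mathfrak C}(\Sigma)$ its ring of colinear endomorphisms under composition, and $$Q=\{q\in\mathrm{Hom}_A(\Sigma,{}^*\mathfrak C)\mid q(x_{[0]})(c)\,x_{[1]}=c_{(1)}\,q(x)(c_{(2)})\ \text{for all } x\in\Sigma,\ c\in\mathfrak C\},$$ with the actions $(fq)(x)=f*q(x)$ and $(qt)(x)=q(t(x))$ for $f\in{}^*\mathfrak C$, $t\in T$. Then the following statements are equivalent: (i) $\Sigma$ is weakly locally projective and a generator in the category $\mathcal M^{\mathfrak C}$ of right $\mathfrak C$-comodules; (ii) there is a (not necessarily unital) subring $R\subseteq T$ such that - $R$ has left local units: for all $r_1,\dots,r_n\in R$ there is $e\in R$ with $er_i=r_i$ for every $i$; - $R$ is a right ideal of $T$; - $R$ acts with local units on $\Sigma$: for all $x_1,\dots,x_n\in\Sigma$ there is $e\in R$ with $e(x_i)=x_i$ for every $i$; - both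 restricted Morita maps $$\Sigma\otimes_{\mathrm{Rat}({}^*\mathfrak C)}Q\to R,\quad x\otimes q\mapsto\bigl(y\mapsto x_{[0]}\,q(y)(x_{[1]})\bigr),\qquad Q\otimes_R\Sigma\to\mathrm{Rat}({}^*\mathfrak C),\quad q\otimes x\mapsto q(x),$$ are surjective. -/

import Mathlib

open MulOpposite
open scoped TensorProduct

universe u

namespace GaloisComodule

/-! ### Balanced tensor products over noncommutative (possibly nonunital) rings -/

section BalTensor

/-- The relations `(m · r) ⊗ n - m ⊗ (r · n)`, for a right action `ρ` on `M` and a left action `l`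
on `N` of elements of `R`. -/
def balancedRel {R M N : Type*} [AddCommGroup M] [AddCommGroup N]
    (ρ : M → R → M) (l : R → N → N) : AddSubgroup (M ⊗[ℤ] N) :=
  AddSubgroup.closure {z | ∃ m r n, z = ρ m r ⊗ₜ[ℤ] n - m ⊗ₜ[ℤ] l r n}

/-- The tensor product `M ⊗_R N` as an abelian group: the quotient of `M ⊗_ℤ N` by the relations
`(m · r) ⊗ n = m ⊗ (r · n)`. -/
abbrev BalTensor {R M N : Type*} [AddCommGroup M] [AddCommGroup N]
    (ρ : M → R → M) (l : R → N → N) : Type _ :=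
  (M ⊗[ℤ] N) ⧸ balancedRel ρ l

/-- The additive map on `M ⊗_R N` induced by a biadditive balanced map. -/
def balLift {R M N P : Type*} [AddCommGroup M] [AddCommGroup N] [AddCommGroup P]
    (ρ : M → R → M) (l : R → N → N) (f : M →+ N →+ P)
    (hf : ∀ m r n, f (ρ m r) n = f m (l r n)) : BalTensor ρ l →+ P :=
  QuotientAddGroup.lift (balancedRel ρ l)
    (TensorProduct.liftAddHom f (fun k m n => by simp))
    ((AddSubgroup.closure_le _).2 (by
      rintro _ ⟨m, r, n, rfl⟩
      change _ = _
      simp [hf]))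

end BalTensor

/-! ### The tensor product of a right and a left module over a ring with unit.
Right `A`-modules are modules over the opposite ring. -/

section NCTensor

variable (A : Type u) [Ring A]
variable (M N : Type u) [AddCommGroup M] [Module Aᵐᵒᵖ M] [AddCommGroup N] [Module A N]

/-- `M ⊗_A N` for a right `A`-module `M` and a left `A`-module `N`. -/
def NCTensor : Type u :=
  BalTensor (fun (m : M) (a : A) => op a • m) (fun (a : A) (n : N) => a • n)

instance : AddCommGroup (NCTensor A M N) :=
  inferInstanceAs (AddCommGroup (BalTensor (fun (m : M) (a : A) => op a • m)
    (fun (a : A) (n : N) => a • n)))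

variable {M N}

/-- The pure tensor `m ⊗_A n`. -/
def tmk (m : M) (n : N) : NCTensor A M N :=
  QuotientAddGroup.mk' (balancedRel (fun (m : M) (a : A) => op a • m)
    (fun (a : A) (n : N) => a • n)) (m ⊗ₜ[ℤ] n)

theorem tmk_add_left (m m' : M) (n : N) : tmk A (m + m') n = tmk A m n + tmk A m' n := by
  simp only [tmk, TensorProduct.add_tmul, map_add]; rfl

theorem tmk_add_right (m : M) (n n' : N) : tmk A m (n + n') = tmk A m n + tmk A m n' := by
  simp only [tmk, TensorProduct.tmul_add, map_add]; rfl

theorem tmk_balanced (m : M) (a : A) (n : N) : tmk A (op a • m) n = tmk A m (a • n) := by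
  refine (QuotientAddGroup.eq_iff_sub_mem).2 (AddSubgroup.subset_closure ⟨m, a, n, rfl⟩)

/-- `tmk` as a biadditive map. -/
def tmkHom : M →+ N →+ NCTensor A M N :=
  AddMonoidHom.mk' (fun m => AddMonoidHom.mk' (fun n => tmk A m n) (tmk_add_right A m))
    (fun m m' => AddMonoidHom.ext fun n => tmk_add_left A m m' n)

variable {A}

/-- The additive map on `M ⊗_A N` induced by a biadditive `A`-balanced map. -/
def tlift {P : Type*} [AddCommGroup P] (f : M →+ N →+ P)
    (hf : ∀ m (a : A) n, f (op a • m) n = f m (a • n)) : NCTensor A M N →+ P :=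
  balLift (fun (m : M) (a : A) => op a • m) (fun (a : A) (n : N) => a • n) f hf

@[simp] theorem tlift_tmk {P : Type*} [AddCommGroup P] (f : M →+ N →+ P)
    (hf : ∀ m (a : A) n, f (op a • m) n = f m (a • n)) (m : M) (n : N) :
    tlift f hf (tmk A m n) = f m n :=
  TensorProduct.liftAddHom_tmul (R := ℤ) f (fun k m n => by simp) m n

@[elab_as_elim]
theorem tensor_induction {p : NCTensor A M N → Prop} (z : NCTensor A M N) (h0 : p 0)
    (h1 : ∀ m n, p (tmk A m n)) (h2 : ∀ x y, p x → p y → p (x + y)) : p z := by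
  obtain ⟨z, rfl⟩ := QuotientAddGroup.mk'_surjective _ z
  induction z using TensorProduct.induction_on with
  | zero => rw [map_zero]; exact h0
  | tmul m n => exact h1 m n
  | add x y hx hy => rw [map_add]; exact h2 _ _ hx hy

theorem tensor_hom_ext {P : Type*} [AddCommGroup P] {f g : NCTensor A M N →+ P}
    (h : ∀ m n, f (tmk A m n) = g (tmk A m n)) : f = g := by
  ext z
  induction z using tensor_induction with
  | h0 => rw [map_zero, map_zero]
  | h1 m n => exact h m n
  | h2 x y hx hy => rw [map_add, map_add, hx, hy]

/-- `f ⊗_A N` for a right `A`-linear map `f`. -/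
def rTensor (N : Type u) [AddCommGroup N] [Module A N]
    {M M' : Type u} [AddCommGroup M] [Module Aᵐᵒᵖ M] [AddCommGroup M'] [Module Aᵐᵒᵖ M']
    (f : M →ₗ[Aᵐᵒᵖ] M') : NCTensor A M N →+ NCTensor A M' N :=
  tlift ((tmkHom A).comp f.toAddMonoidHom) (fun m a n => by
    change tmk A (f (op a • m)) n = tmk A (f m) (a • n)
    rw [map_smul, tmk_balanced])

@[simp] theorem rTensor_tmk {M M' : Type u} [AddCommGroup M] [Module Aᵐᵒᵖ M] [AddCommGroup M']
    [Module Aᵐᵒᵖ M'] (f : M →ₗ[Aᵐᵒᵖ] M') (m : M) (n : N) :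
    rTensor N f (tmk A m n) = tmk A (f m) n := by
  rw [rTensor, tlift_tmk]; rfl

end NCTensor

/-! ### Module structures on `M ⊗_A N` -/

section NCTensorModule

variable {A : Type u} [Ring A]
variable {M N : Type u} [AddCommGroup M] [Module Aᵐᵒᵖ M] [AddCommGroup N] [Module A N]

/-- The left action `a (m ⊗ n) = (a m) ⊗ n` when `M` is a bimodule. -/
def leftAct [Module A M] [SMulCommClass A Aᵐᵒᵖ M] :
    A →+* AddMonoid.End (NCTensor A M N) where
  toFun a := tlift ((tmkHom A).comp (DistribSMul.toAddMonoidHom M a)) (fun m b n => by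
    change tmk A (a • op b • m) n = tmk A (a • m) (b • n)
    rw [smul_comm, tmk_balanced])
  map_one' := tensor_hom_ext fun m n => by
    rw [tlift_tmk]; change tmk A ((1 : A) • m) n = tmk A m n; rw [one_smul]
  map_mul' a b := tensor_hom_ext fun m n => by
    rw [tlift_tmk]
    change tmk A ((a * b) • m) n = tmk A (a • b • m) n
    rw [mul_smul]
  map_zero' := tensor_hom_ext fun m n => by
    rw [tlift_tmk]
    change tmkHom A ((0 : A) • m) n = 0
    simp
  map_add' a b := tensor_hom_ext fun m n => by
    rw [tlift_tmk]
    change tmk A ((a + b) • m) n = tmk A (a • m) n + tmk A (b • m) n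
    rw [add_smul, tmk_add_left]

/-- The right action `(m ⊗ n) a = m ⊗ (n a)` when `N` is a bimodule. -/
def rightAct [Module Aᵐᵒᵖ N] [SMulCommClass A Aᵐᵒᵖ N] :
    Aᵐᵒᵖ →+* AddMonoid.End (NCTensor A M N) where
  toFun a := tlift ((AddMonoidHom.compHom' (DistribSMul.toAddMonoidHom N a)).comp (tmkHom A))
    (fun m b n => by
      change tmk A (op b • m) (a • n) = tmk A m (a • b • n)
      rw [tmk_balanced, smul_comm])
  map_one' := tensor_hom_ext fun m n => by
    rw [tlift_tmk]; change tmk A m ((1 : Aᵐᵒᵖ) • n) = tmk A m n; rw [one_smul]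
  map_mul' a b := tensor_hom_ext fun m n => by
    rw [tlift_tmk]
    change tmk A m ((a * b) • n) = tmk A m (a • b • n)
    rw [mul_smul]
  map_zero' := tensor_hom_ext fun m n => by
    rw [tlift_tmk]
    change tmkHom A m ((0 : Aᵐᵒᵖ) • n) = 0
    simp
  map_add' a b := tensor_hom_ext fun m n => by
    rw [tlift_tmk]
    change tmk A m ((a + b) • n) = tmk A m (a • n) + tmk A m (b • n)
    rw [add_smul, tmk_add_right]

instance [Module A M] [SMulCommClass A Aᵐᵒᵖ M] : Module A (NCTensor A M N) :=
  Module.compHom (NCTensor A M N) (leftAct (A := A) (M := M) (N := N))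

instance [Module Aᵐᵒᵖ N] [SMulCommClass A Aᵐᵒᵖ N] : Module Aᵐᵒᵖ (NCTensor A M N) :=
  Module.compHom (NCTensor A M N) (rightAct (A := A) (M := M) (N := N))

@[simp] theorem smul_tmk [Module A M] [SMulCommClass A Aᵐᵒᵖ M] (a : A) (m : M) (n : N) :
    a • tmk A m n = tmk A (a • m) n :=
  rfl

@[simp] theorem op_smul_tmk [Module Aᵐᵒᵖ N] [SMulCommClass A Aᵐᵒᵖ N] (a : Aᵐᵒᵖ) (m : M)
    (n : N) :
    a • tmk A m n = tmk A m (a • n) :=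
  rfl

/-- `n ↦ m ⊗ n` as a right `A`-linear map, for a bimodule `N`. -/
def tmkRight (N : Type u) [AddCommGroup N] [Module A N] [Module Aᵐᵒᵖ N] [SMulCommClass A Aᵐᵒᵖ N]
    (m : M) : N →ₗ[Aᵐᵒᵖ] NCTensor A M N where
  toFun n := tmk A m n
  map_add' := tmk_add_right A m
  map_smul' a n := (op_smul_tmk a m n).symm

/-- `m ⊗ n ↦ m f(n)` for a left `A`-linear `f : N → A`. -/
def contract (M : Type u) [AddCommGroup M] [Module Aᵐᵒᵖ M] (f : N →ₗ[A] A) :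
    NCTensor A M N →+ M :=
  tlift (AddMonoidHom.mk' (fun m => AddMonoidHom.mk' (fun n => op (f n) • m)
      (fun n n' => by rw [map_add, MulOpposite.op_add, add_smul]))
      (fun m m' => AddMonoidHom.ext fun n => smul_add (op (f n)) m m'))
    (fun m a n => by
      change op (f n) • op a • m = op (f (a • n)) • m
      rw [map_smul, smul_eq_mul, op_mul, mul_smul])

/-- `m ⊗ n ↦ g(m) n` for a right `A`-linear `g : M → A`. -/
def contractLeft (N : Type u) [AddCommGroup N] [Module A N] (g : M →ₗ[Aᵐᵒᵖ] A) :
    NCTensor A M N →+ N :=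
  tlift (AddMonoidHom.mk' (fun m => AddMonoidHom.mk' (fun n => g m • n) (smul_add (g m)))
      (fun m m' => AddMonoidHom.ext fun n => by
        change g (m + m') • n = g m • n + g m' • n
        rw [map_add, add_smul]))
    (fun m a n => by
      change g (op a • m) • n = g m • a • n
      rw [map_smul, op_smul_eq_mul, mul_smul])

@[simp] theorem contract_tmk (f : N →ₗ[A] A) (m : M) (n : N) :
    contract M f (tmk A m n) = op (f n) • m :=
  tlift_tmk _ _ m n

@[simp] theorem contractLeft_tmk (g : M →ₗ[Aᵐᵒᵖ] A) (m : M) (n : N) :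
    contractLeft N g (tmk A m n) = g m • n :=
  tlift_tmk _ _ m n

/-- `M ⊗_A g` for a left `A`-linear map `g`. -/
def lTensor (M : Type u) [AddCommGroup M] [Module Aᵐᵒᵖ M] {N' : Type u} [AddCommGroup N']
    [Module A N'] (g : N →ₗ[A] N') : NCTensor A M N →+ NCTensor A M N' :=
  tlift ((AddMonoidHom.compHom' g.toAddMonoidHom).comp (tmkHom A)) (fun m a n => by
    change tmk A (op a • m) (g n) = tmk A m (g (a • n))
    rw [map_smul, tmk_balanced])

@[simp] theorem lTensor_tmk {N' : Type u} [AddCommGroup N'] [Module A N'] (g : N →ₗ[A] N')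
    (m : M) (n : N) : lTensor M g (tmk A m n) = tmk A m (g n) :=
  tlift_tmk _ _ m n

/-- The canonical map `M ⊗ (N ⊗ P) → (M ⊗ N) ⊗ P`, `m ⊗ (n ⊗ p) ↦ (m ⊗ n) ⊗ p`
(an isomorphism), for a bimodule `N`. -/
def tassoc (M N P : Type u) [AddCommGroup M] [Module Aᵐᵒᵖ M] [AddCommGroup N] [Module A N]
    [Module Aᵐᵒᵖ N] [SMulCommClass A Aᵐᵒᵖ N] [AddCommGroup P] [Module A P] :
    NCTensor A M (NCTensor A N P) →+ NCTensor A (NCTensor A M N) P :=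
  tlift (AddMonoidHom.mk' (fun m => rTensor P (tmkRight N m)) (fun x y =>
      tensor_hom_ext fun n p => by
        rw [AddMonoidHom.add_apply, rTensor_tmk, rTensor_tmk, rTensor_tmk, ← tmk_add_left]
        exact congrArg (fun t => tmk A t p) (tmk_add_left A x y n)))
    (fun m a z => by
      change rTensor P (tmkRight N (op a • m)) z = rTensor P (tmkRight N m) (a • z)
      induction z using tensor_induction with
      | h0 => rw [smul_zero, map_zero, map_zero]
      | h1 n p =>
        rw [smul_tmk, rTensor_tmk, rTensor_tmk]
        exact congrArg (fun t => tmk A t p) (tmk_balanced A m a n)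
      | h2 x y hx hy => rw [smul_add, map_add, map_add, hx, hy])

theorem tassoc_tmk (P : Type u) [Module Aᵐᵒᵖ N] [SMulCommClass A Aᵐᵒᵖ N] [AddCommGroup P]
    [Module A P] (m : M) (z : NCTensor A N P) :
    tassoc M N P (tmk A m z) = rTensor P (tmkRight N m) z :=
  tlift_tmk _ _ m z

end NCTensorModule

/-! ### Corings and comodules -/

/-- An `A`-coring structure on the `A`-bimodule `C`: an `A`-bilinear coassociative comultiplication
`Δ : C → C ⊗_A C` with an `A`-bilinear counit `ε : C → A`. -/
class Coring (A : Type u) [Ring A] (C : Type u) [AddCommGroup C] [Module A C] [Module Aᵐᵒᵖ C]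
    [SMulCommClass A Aᵐᵒᵖ C] where
  /-- the comultiplication -/
  comul : C →ₗ[A] NCTensor A C C
  comul_op_smul : ∀ (a : Aᵐᵒᵖ) (c : C), comul (a • c) = a • comul c
  /-- the counit -/
  counit : C →ₗ[A] A
  counit_op_smul : ∀ (a : Aᵐᵒᵖ) (c : C), counit (a • c) = a • counit c
  coassoc : ∀ c : C, tassoc C C C (lTensor C comul (comul c)) =
    rTensor C { toFun := comul, map_add' := map_add comul, map_smul' := comul_op_smul } (comul c)
  counit_left : ∀ c : C, contractLeft C
    { toFun := counit, map_add' := map_add counit, map_smul' := counit_op_smul } (comul c) = c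
  counit_right : ∀ c : C, contract C counit (comul c) = c

section

variable (A : Type u) [Ring A] (C : Type u) [AddCommGroup C] [Module A C] [Module Aᵐᵒᵖ C]
  [SMulCommClass A Aᵐᵒᵖ C] [Coring A C]

/-- A right `C`-comodule structure on a right `A`-module `M`: a right `A`-linear coassociative and
counital coaction. -/
structure ComoduleStr (M : Type u) [AddCommGroup M] [Module Aᵐᵒᵖ M] where
  /-- the coaction -/
  coact : M →ₗ[Aᵐᵒᵖ] NCTensor A M C
  coassoc : ∀ m, tassoc M C C (lTensor M (Coring.comul (A := A) (C := C)) (coact m)) =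
    rTensor C coact (coact m)
  counit : ∀ m, contract M (Coring.counit (A := A) (C := C)) (coact m) = m

/-- Right `C`-comodules. -/
structure Comod where
  /-- the underlying type -/
  carrier : Type u
  [addCommGroup : AddCommGroup carrier]
  [module : Module Aᵐᵒᵖ carrier]
  /-- the comodule structure -/
  str : ComoduleStr A C carrier

attribute [instance] Comod.addCommGroup Comod.module

instance : CoeSort (Comod A C) (Type u) := ⟨Comod.carrier⟩

variable {A C}

/-- Right `C`-colinear maps. -/
@[ext]
structure Comod.Hom (M N : Comod A C) where
  /-- the underlying right `A`-linear map -/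
  toLin : M →ₗ[Aᵐᵒᵖ] N
  colinear : ∀ m, N.str.coact (toLin m) = rTensor C toLin (M.str.coact m)

theorem rTensor_id {M N : Type u} [AddCommGroup M] [Module Aᵐᵒᵖ M] [AddCommGroup N] [Module A N]
    (z : NCTensor A M N) : rTensor N (LinearMap.id : M →ₗ[Aᵐᵒᵖ] M) z = z := by
  induction z using tensor_induction with
  | h0 => rw [map_zero]
  | h1 m n => rw [rTensor_tmk]; rfl
  | h2 x y hx hy => rw [map_add, hx, hy]

theorem rTensor_comp {M M' M'' N : Type u} [AddCommGroup M] [Module Aᵐᵒᵖ M] [AddCommGroup M']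
    [Module Aᵐᵒᵖ M'] [AddCommGroup M''] [Module Aᵐᵒᵖ M''] [AddCommGroup N] [Module A N]
    (f : M →ₗ[Aᵐᵒᵖ] M') (g : M' →ₗ[Aᵐᵒᵖ] M'') (z : NCTensor A M N) :
    rTensor N (g.comp f) z = rTensor N g (rTensor N f z) := by
  induction z using tensor_induction with
  | h0 => rw [map_zero, map_zero, map_zero]
  | h1 m n => rw [rTensor_tmk, rTensor_tmk, rTensor_tmk]; rfl
  | h2 x y hx hy => rw [map_add, map_add, map_add, hx, hy]

theorem rTensor_add {M M' N : Type u} [AddCommGroup M] [Module Aᵐᵒᵖ M] [AddCommGroup M']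
    [Module Aᵐᵒᵖ M'] [AddCommGroup N] [Module A N]
    (f g : M →ₗ[Aᵐᵒᵖ] M') (z : NCTensor A M N) :
    rTensor N (f + g) z = rTensor N f z + rTensor N g z := by
  induction z using tensor_induction with
  | h0 => rw [map_zero, map_zero, map_zero, add_zero]
  | h1 m n => rw [rTensor_tmk, rTensor_tmk, rTensor_tmk, ← tmk_add_left]; rfl
  | h2 x y hx hy => rw [map_add, map_add, map_add, hx, hy]; abel

/-- The category of right `C`-comodules. -/
instance : CategoryTheory.Category (Comod A C) where
  Hom := Comod.Hom
  id M := ⟨LinearMap.id, fun m => (rTensor_id _).symm⟩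
  comp f g := ⟨g.toLin.comp f.toLin, fun m => by
    rw [rTensor_comp, ← f.colinear, ← g.colinear]; rfl⟩

/-- The ring `T = End^C(Σ)` of colinear endomorphisms, multiplication being composition. -/
def comodEnd (S : Comod A C) : Subring (Module.End Aᵐᵒᵖ S) where
  carrier := {t | ∀ x, S.str.coact (t x) = rTensor C t (S.str.coact x)}
  mul_mem' {s t} hs ht x := by
    change S.str.coact (s (t x)) = rTensor C (s.comp t) _
    rw [hs, ht, rTensor_comp]
  one_mem' x := (rTensor_id _).symm
  add_mem' {s t} hs ht x := by
    rw [rTensor_add, ← hs, ← ht, ← map_add]; rfl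
  zero_mem' x := by
    have h := rTensor_add (0 : S →ₗ[Aᵐᵒᵖ] S) 0 (S.str.coact x)
    rw [add_zero, left_eq_add] at h
    exact (map_zero _).trans h.symm
  neg_mem' {t} ht x := by
    have h := rTensor_add t (-t) (S.str.coact x)
    have h0 := rTensor_add (0 : S →ₗ[Aᵐᵒᵖ] S) 0 (S.str.coact x)
    rw [add_zero, left_eq_add] at h0
    rw [add_neg_cancel, h0, ← ht] at h
    rw [LinearMap.neg_apply, map_neg]
    exact neg_eq_of_add_eq_zero_right h.symm

end

/-! ### Weakly locally projective objects -/

section Categorical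

open CategoryTheory

/-- A finitely generated object: whenever it is the sum (join) of a directed family of subobjects,
it equals one of them. -/
def IsFinGenObj {𝒞 : Type*} [Category 𝒞] (X : 𝒞) : Prop :=
  ∀ s : Set (Subobject X), s.Nonempty → DirectedOn (· ≤ ·) s → IsLUB s ⊤ → ⊤ ∈ s

/-- `X` is weakly locally projective: for exact `0 → E → X` with `E` finitely generated, exact
`M → N → 0` and `f : X → N` there is `h : X → M` with `g ∘ h ∘ i = f ∘ i`. -/
def IsWeaklyLocallyProjective {𝒞 : Type*} [Category 𝒞] (X : 𝒞) : Prop :=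
  ∀ (E M N : 𝒞) (i : E ⟶ X) (f : X ⟶ N) (g : M ⟶ N), Mono i → Epi g → IsFinGenObj E →
    ∃ h : X ⟶ M, i ≫ h ≫ g = i ≫ f

end Categorical

/-! ### The left dual ring, its rational part and the finite topology -/

section Dual

variable (A : Type u) [Ring A] (C : Type u) [AddCommGroup C] [Module A C] [Module Aᵐᵒᵖ C]
  [SMulCommClass A Aᵐᵒᵖ C]

/-- The left dual `*C = Hom_A(C, A)` of left `A`-linear maps. It is a right `A`-module by
`(f a)(c) = f(c) a`. -/
abbrev LeftDual : Type u := C →ₗ[A] A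

/-- The finite topology on `*C`: induced by the product topology on `A ^ C` for discrete `A`. -/
@[reducible]
def finiteTopology : TopologicalSpace (LeftDual A C) :=
  TopologicalSpace.induced (fun f c => f c) (@Pi.topologicalSpace C (fun _ => A) (fun _ => ⊥))

variable {A C}

theorem contract_smul {M N : Type u} [AddCommGroup M] [Module A M] [Module Aᵐᵒᵖ M]
    [SMulCommClass A Aᵐᵒᵖ M] [AddCommGroup N] [Module A N] (f : N →ₗ[A] A) (a : A)
    (z : NCTensor A M N) : contract M f (a • z) = a • contract M f z := by
  induction z using tensor_induction with
  | h0 => rw [smul_zero, map_zero, smul_zero]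
  | h1 m n => rw [smul_tmk, contract_tmk, contract_tmk, smul_comm a]
  | h2 x y hx hy => rw [smul_add, map_add, map_add, smul_add, hx, hy]

/-- `c ↦ c₍₁₎ f(c₍₂₎)`, a left `A`-linear endomorphism of `C`. -/
def hit [Coring A C] (f : LeftDual A C) : C →ₗ[A] C where
  toFun c := contract C f (Coring.comul (A := A) c)
  map_add' x y := by rw [map_add, map_add]
  map_smul' a c := by rw [map_smul, contract_smul]; rfl

/-- The product `(f * g)(c) = g(c₍₁₎ f(c₍₂₎))` of `*C`. -/
def conv [Coring A C] (f g : LeftDual A C) : LeftDual A C := g.comp (hit f)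

variable (A C) in
/-- `Rat(*C)`: the largest right `A`-submodule `N` of `*C` that carries a `C`-comodule structure
with `n * f = n₍₀₎ f(n₍₁₎)` for all `n ∈ N` and `f ∈ *C`. -/
def ratDual [Coring A C] : Submodule Aᵐᵒᵖ (LeftDual A C) :=
  sSup {N | ∃ ρ : ComoduleStr A C N, ∀ (n : N) (f : LeftDual A C),
    conv (n : LeftDual A C) f = (contract N f (ρ.coact n) : N)}

end Dual

/-! ### The Morita context of a comodule -/

section Morita

variable {A : Type u} [Ring A] {C : Type u} [AddCommGroup C] [Module A C] [Module Aᵐᵒᵖ C]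
  [SMulCommClass A Aᵐᵒᵖ C] [Coring A C]

theorem contract_add_fun {M N : Type u} [AddCommGroup M] [Module Aᵐᵒᵖ M] [AddCommGroup N]
    [Module A N] (f g : N →ₗ[A] A) (z : NCTensor A M N) :
    contract M (f + g) z = contract M f z + contract M g z := by
  induction z using tensor_induction with
  | h0 => rw [map_zero, map_zero, map_zero, add_zero]
  | h1 m n =>
    rw [contract_tmk, contract_tmk, contract_tmk, LinearMap.add_apply, MulOpposite.op_add, add_smul]
  | h2 x y hx hy => rw [map_add, map_add, map_add, hx, hy]; abel

theorem contract_op_smul_fun {M N : Type u} [AddCommGroup M] [Module Aᵐᵒᵖ M] [AddCommGroup N]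
    [Module A N] (a : Aᵐᵒᵖ) (f : N →ₗ[A] A) (z : NCTensor A M N) :
    contract M (a • f) z = a • contract M f z := by
  induction z using tensor_induction with
  | h0 => rw [map_zero, map_zero, smul_zero]
  | h1 m n =>
    rw [contract_tmk, contract_tmk, LinearMap.smul_apply, ← mul_smul]
    rfl
  | h2 x y hx hy => rw [map_add, map_add, smul_add, hx, hy]

/-- The right `A`-linear map `x ↦ q(x)(c)`. -/
def evalAt {M : Type u} [AddCommGroup M] [Module Aᵐᵒᵖ M] (q : M →ₗ[Aᵐᵒᵖ] LeftDual A C) (c : C) :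
    M →ₗ[Aᵐᵒᵖ] A where
  toFun x := q x c
  map_add' x y := by rw [map_add]; rfl
  map_smul' a x := by rw [map_smul]; rfl

theorem contractLeft_add_fun {M N : Type u} [AddCommGroup M] [Module Aᵐᵒᵖ M] [AddCommGroup N]
    [Module A N] (f g : M →ₗ[Aᵐᵒᵖ] A) (z : NCTensor A M N) :
    contractLeft N (f + g) z = contractLeft N f z + contractLeft N g z := by
  induction z using tensor_induction with
  | h0 => rw [map_zero, map_zero, map_zero, add_zero]
  | h1 m n =>
    rw [contractLeft_tmk, contractLeft_tmk, contractLeft_tmk, LinearMap.add_apply, add_smul]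
  | h2 x y hx hy => rw [map_add, map_add, map_add, hx, hy]; abel

/-- `Q`: the right `A`-linear `q : Σ → *C` with
`q(x₍₀₎)(c) x₍₁₎ = c₍₁₎ q(x)(c₍₂₎)` for all `x ∈ Σ`, `c ∈ C`. -/
def comodQ (S : Comod A C) : AddSubgroup (S →ₗ[Aᵐᵒᵖ] LeftDual A C) where
  carrier := {q | ∀ (x : S) (c : C),
    contractLeft C (evalAt q c) (S.str.coact x) = contract C (q x) (Coring.comul (A := A) c)}
  add_mem' {p q} hp hq x c := by
    rw [LinearMap.add_apply, contract_add_fun, ← hp, ← hq, ← contractLeft_add_fun]; rfl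
  zero_mem' x c := by
    have h1 := contractLeft_add_fun (evalAt (0 : S →ₗ[Aᵐᵒᵖ] LeftDual A C) c)
      (evalAt 0 c) (S.str.coact x)
    have h2 := contract_add_fun (0 : C →ₗ[A] A) 0 (Coring.comul (A := A) c)
    have h3 : evalAt (0 : S →ₗ[Aᵐᵒᵖ] LeftDual A C) c + evalAt 0 c = evalAt 0 c := by
      ext y; exact add_zero (0 : A)
    rw [h3, left_eq_add] at h1
    rw [add_zero, left_eq_add] at h2
    exact h1.trans h2.symm
  neg_mem' {q} hq x c := by
    have h0 := contract_add_fun (0 : C →ₗ[A] A) 0 (Coring.comul (A := A) c)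
    rw [add_zero, left_eq_add] at h0
    have h1 := contractLeft_add_fun (evalAt q c) (evalAt (-q) c) (S.str.coact x)
    have h2 := contract_add_fun (q x) (-q x) (Coring.comul (A := A) c)
    have h4 := contractLeft_add_fun (0 : S →ₗ[Aᵐᵒᵖ] A) 0 (S.str.coact x)
    rw [add_zero, left_eq_add] at h4
    have h3 : evalAt q c + evalAt (-q) c = 0 := by
      ext y; exact add_neg_cancel (q y c)
    rw [h3, h4, hq] at h1
    rw [add_neg_cancel, h0] at h2
    exact add_left_cancel (h1.symm.trans h2)

/-- The right action `x · f = x₍₀₎ f(x₍₁₎)` of `*C` on a comodule. -/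
def dualAct (S : Comod A C) (x : S) (f : LeftDual A C) : S := contract S f (S.str.coact x)

theorem contractLeft_comp {M M' N : Type u} [AddCommGroup M] [Module Aᵐᵒᵖ M] [AddCommGroup M']
    [Module Aᵐᵒᵖ M'] [AddCommGroup N] [Module A N]
    (t : M →ₗ[Aᵐᵒᵖ] M') (f : M' →ₗ[Aᵐᵒᵖ] A) (z : NCTensor A M N) :
    contractLeft N (f.comp t) z = contractLeft N f (rTensor N t z) := by
  induction z using tensor_induction with
  | h0 => rw [map_zero, map_zero, map_zero]
  | h1 m n => rw [rTensor_tmk, contractLeft_tmk, contractLeft_tmk]; rfl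
  | h2 x y hx hy => rw [map_add, map_add, map_add, hx, hy]

/-- The right action `(q t)(x) = q(t(x))` of `T` on `Q`. -/
def actQT {S : Comod A C} (q : comodQ S) (t : comodEnd S) : comodQ S :=
  ⟨q.1.comp t.1, fun x c => by
    change contractLeft C ((evalAt q.1 c).comp t.1) _ = contract C (q.1 (t.1 x)) _
    rw [contractLeft_comp, ← t.2, q.2]⟩

/-- Contraction is natural in right `A`-linear maps. -/
theorem contract_rTensor {M M' N : Type u} [AddCommGroup M] [Module Aᵐᵒᵖ M] [AddCommGroup M']
    [Module Aᵐᵒᵖ M'] [AddCommGroup N] [Module A N]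
    (t : M →ₗ[Aᵐᵒᵖ] M') (f : N →ₗ[A] A) (z : NCTensor A M N) :
    contract M' f (rTensor N t z) = t (contract M f z) := by
  induction z using tensor_induction with
  | h0 => rw [map_zero, map_zero, map_zero, map_zero]
  | h1 m n => rw [rTensor_tmk, contract_tmk, contract_tmk, map_smul]
  | h2 x y hx hy => rw [map_add, map_add, map_add, map_add, hx, hy]

/-- `(M ⊗ C) ⊗ C → M ⊗ C` contracts `m₍₀₎ ⊗ c₍₁₎ ⊗ c₍₂₎` to `m ⊗ c₍₁₎ f(c₍₂₎)`. -/
theorem contract_tassoc_comul {M : Type u} [AddCommGroup M] [Module Aᵐᵒᵖ M]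
    (f : LeftDual A C) (z : NCTensor A M C) :
    contract (NCTensor A M C) f (tassoc M C C (lTensor M (Coring.comul (A := A) (C := C)) z)) =
      lTensor M (hit f) z := by
  induction z using tensor_induction with
  | h0 => rw [map_zero, map_zero, map_zero, map_zero]
  | h1 m c => rw [lTensor_tmk, tassoc_tmk, contract_rTensor, lTensor_tmk]; rfl
  | h2 x y hx hy => rw [map_add, map_add, map_add, map_add, hx, hy]

/-- `Δ(c₍₁₎ f(c₍₂₎)) = c₍₁₎ ⊗ c₍₂₎ f(c₍₃₎)`. -/
theorem comul_hit (f : LeftDual A C) (c : C) :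
    Coring.comul (A := A) (hit f c) = lTensor C (hit f) (Coring.comul (A := A) c) := by
  rw [← contract_tassoc_comul, Coring.coassoc, contract_rTensor]; rfl

/-- `ρ(x₍₀₎ f(x₍₁₎)) = x₍₀₎ ⊗ x₍₁₎ f(x₍₂₎)`. -/
theorem coact_dualAct (S : Comod A C) (f : LeftDual A C) (x : S) :
    S.str.coact (dualAct S x f) = lTensor S (hit f) (S.str.coact x) := by
  rw [← contract_tassoc_comul, S.str.coassoc, contract_rTensor]; rfl

theorem contract_lTensor {M N N' : Type u} [AddCommGroup M] [Module Aᵐᵒᵖ M] [AddCommGroup N]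
    [Module A N] [AddCommGroup N'] [Module A N']
    (g : N →ₗ[A] N') (f : N' →ₗ[A] A) (z : NCTensor A M N) :
    contract M f (lTensor M g z) = contract M (f.comp g) z := by
  induction z using tensor_induction with
  | h0 => rw [map_zero, map_zero, map_zero]
  | h1 m n => rw [lTensor_tmk, contract_tmk, contract_tmk]; rfl
  | h2 x y hx hy => rw [map_add, map_add, map_add, hx, hy]

/-- The left action `(f q)(x) = f * q(x)` of `*C` on `Q`. -/
def actDualQ {S : Comod A C} (f : LeftDual A C) (q : comodQ S) : comodQ S :=
  ⟨{ toFun := fun x => conv f (q.1 x)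
     map_add' := fun x y => by rw [map_add]; rfl
     map_smul' := fun a x => by rw [map_smul]; rfl },
   fun x c => by
    change contractLeft C (evalAt q.1 (hit f c)) _ = contract C ((q.1 x).comp (hit f)) _
    rw [q.2, comul_hit, contract_lTensor]⟩

/-- The endomorphism `y ↦ x q(y)(c)` of `Σ` attached to `x ⊗ c` in `Σ ⊗ C`, extended additively. -/
def triAux {S : Comod A C} (q : S →ₗ[Aᵐᵒᵖ] LeftDual A C) (z : NCTensor A S C) :
    Module.End Aᵐᵒᵖ S where
  toFun y := contract S (q y) z
  map_add' y w := by rw [map_add]; exact contract_add_fun _ _ _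
  map_smul' a y := by rw [map_smul]; exact contract_op_smul_fun _ _ _

theorem rTensor_triAux {S : Comod A C} (q : comodQ S) (y : S) (z : NCTensor A S C) :
    rTensor C (triAux q.1 z) (S.str.coact y) = lTensor S (hit (q.1 y)) z := by
  have hz : ∀ u : NCTensor A S C, rTensor C (0 : Module.End Aᵐᵒᵖ S) u = 0 := fun u => by
    have h := rTensor_add (0 : S →ₗ[Aᵐᵒᵖ] S) 0 u
    rwa [add_zero, left_eq_add] at h
  induction z using tensor_induction with
  | h0 =>
    have h : triAux q.1 (0 : NCTensor A S C) = 0 := LinearMap.ext fun w => map_zero (contract S (q.1 w))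
    rw [h, hz, map_zero]
  | h1 m c =>
    have hh : hit (q.1 y) c = contractLeft C (evalAt q.1 c) (S.str.coact y) := (q.2 y c).symm
    rw [lTensor_tmk, hh]
    generalize S.str.coact y = u
    induction u using tensor_induction with
    | h0 => rw [map_zero, map_zero]; exact (map_zero (tmkHom A m)).symm
    | h1 w d =>
      rw [rTensor_tmk, contractLeft_tmk, ← tmk_balanced]
      exact congrArg (fun t => tmk A t d) (contract_tmk (q.1 w) m c)
    | h2 u v hu hv => rw [map_add, map_add, tmk_add_right, hu, hv]
  | h2 z w hz hw =>
    have h : triAux q.1 (z + w) = triAux q.1 z + triAux q.1 w :=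
      LinearMap.ext fun v => map_add (contract S (q.1 v)) _ _
    rw [h, rTensor_add, hz, hw, map_add]

/-- The element `x ◁ q = (y ↦ x₍₀₎ q(y)(x₍₁₎))` of `T`. -/
def tri {S : Comod A C} (x : S) (q : comodQ S) : comodEnd S :=
  ⟨triAux q.1 (S.str.coact x), fun y => by
    rw [rTensor_triAux]
    exact coact_dualAct S (q.1 y) x⟩

/-- `(x, q) ↦ x ◁ q` as a biadditive map. -/
def triHom (S : Comod A C) : S →+ comodQ S →+ comodEnd S :=
  AddMonoidHom.mk' (fun x => AddMonoidHom.mk' (fun q => tri x q) (fun p q =>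
      Subtype.ext (LinearMap.ext fun y => contract_add_fun (p.1 y) (q.1 y) (S.str.coact x))))
    (fun x y => AddMonoidHom.ext fun q => Subtype.ext (LinearMap.ext fun w => by
      change contract S (q.1 w) (S.str.coact (x + y)) =
        contract S (q.1 w) (S.str.coact x) + contract S (q.1 w) (S.str.coact y)
      rw [map_add, map_add]))

/-- `(x · f) ◁ q = x ◁ (f q)`. -/
theorem tri_balanced {S : Comod A C} (x : S) (f : LeftDual A C) (q : comodQ S) :
    tri (dualAct S x f) q = tri x (actDualQ f q) := by
  refine Subtype.ext (LinearMap.ext fun y => ?_)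
  change contract S (q.1 y) (S.str.coact (dualAct S x f)) =
    contract S ((q.1 y).comp (hit f)) (S.str.coact x)
  rw [coact_dualAct, contract_lTensor]

/-- `(q, x) ↦ q ▲ x = q(x)` as a biadditive map. -/
def btriHom (S : Comod A C) : comodQ S →+ S →+ LeftDual A C :=
  AddMonoidHom.mk' (fun q => q.1.toAddMonoidHom) (fun _ _ => rfl)

/-- The Morita map `◁ : Σ ⊗_{Rat(*C)} Q → T` of the context restricted to `Rat(*C)`. The values
lie in any right ideal `R` of `T` acting with local units on `Σ`, so the doubly restricted map
`Σ ⊗_{Rat(*C)} Q → R` is its corestriction. -/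
def restrictedTri (S : Comod A C) :
    BalTensor (fun (x : S) (s : ratDual A C) => dualAct S x s.1)
      (fun (s : ratDual A C) (q : comodQ S) => actDualQ s.1 q) →+ comodEnd S :=
  balLift _ _ (triHom S) (fun x s q => tri_balanced x s.1 q)

/-- The Morita map `▲ : Q ⊗_R Σ → *C` of the context restricted to a nonunital subring `R ⊆ T`.
The values lie in `Rat(*C)` when `C` is weakly locally projective as a left `A`-module, so the
doubly restricted map `Q ⊗_R Σ → Rat(*C)` is its corestriction. -/
def restrictedBtri (S : Comod A C) (R : NonUnitalSubring (comodEnd S)) :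
    BalTensor (fun (q : comodQ S) (r : R) => actQT q r.1)
      (fun (r : R) (x : S) => r.1.1 x) →+ LeftDual A C :=
  balLift _ _ (btriHom S) (fun _ _ _ => rfl)

/-- Every finite subset of `R` has a left unit in `R`. -/
def HasLeftLocalUnits {T : Type*} [Ring T] (R : NonUnitalSubring T) : Prop :=
  ∀ F : Finset R, ∃ e : R, ∀ r ∈ F, e * r = r

/-- For every finite subset of `Σ` some element of `R` acts on it as the identity. -/
def ActsWithLocalUnits {S : Comod A C} (R : NonUnitalSubring (comodEnd S)) : Prop :=
  ∀ F : Finset S, ∃ e ∈ R, ∀ x ∈ F, e.1 x = x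

/-- `R` is a right ideal of `T`. -/
def IsRightIdeal {T : Type*} [Ring T] (R : NonUnitalSubring T) : Prop :=
  ∀ r ∈ R, ∀ t : T, r * t ∈ R

end Morita

end GaloisComodule

namespace GaloisComodule

/-! ### Local dual bases of weakly locally projective modules -/

section LocallyProjective

open CategoryTheory

/-! Weak local projectivity of `C` over `A` means that finitely many elements of `C` always have a
finite dual basis (`exists_dual_basis`). Hence a tensor in `M ⊗ C` is determined by its contractions
against `*C` (`tensor_ext_contract`), and comodules become rational `*C`-modules
(`exists_comoduleStr`): subcomodules and quotients are those by `*C`-stable submodules, colinear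
maps are the `A`-linear maps respecting the action, monos and epis are the injections and
surjections, and finitely generated objects are those generated by a finite set. Likewise `Rat(*C)`
is itself a comodule, and `Q` amounts to the colinear maps `Σ → Rat(*C)`. Density supplies, for each
element `x` of a comodule, some `r ∈ Rat(*C)` with `x · r = x`.

From (ii) to (i): for `m ∈ M` and `q ∈ Q` the map `x ↦ m · q(x)` is colinear. Choosing `r` with `m ·
r = m` and writing `r = ∑ qᵢ(xᵢ)` expresses `m` through values of such maps, so `Σ` is a generator.
To lift `f : Σ → N` along an epi `g : M → N` on a finitely generated part, take a local unit `e = ∑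
yⱼ ◁ qⱼ`, choose `mⱼ` over `f(yⱼ)`, and use `x ↦ ∑ mⱼ · qⱼ(x)`, which lifts `f ∘ e`.

From (i) to (ii): let `R` be the image of `◁`. By density the maps `r ↦ y · r` assemble to an epi
`Rat(*C)^(Σ) → Σ`. Lifting the identity of `Σ` along it on the subcomodule generated by a finite set
gives components `q_y ∈ Q`, and `∑ y ◁ q_y` is a local unit (`actsWithLocalUnits_triRange`). The
image of `▲` is a subcomodule of `Rat(*C)` containing every value of every colinear map from `Σ`, so
a generator forces it to be everything (`range_restrictedBtri_eq`). -/

theorem isFinGenObj_of_fg {A : Type u} [Ring A] {C : Type u} [AddCommGroup C] [Module A C]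
    [Module.Finite A C] : IsFinGenObj (ModuleCat.of A C) := by
  intro s hne hdir hlub
  -- Subobjects correspond to submodules, where finite generation is compactness in the lattice.
  let φ := (ModuleCat.of A C).subobjectModule
  have hc : IsCompactElement (⊤ : Submodule A C) :=
    (Submodule.fg_iff_compact _).1 Module.Finite.fg_top
  have hlub' : IsLUB (φ '' s) (φ ⊤) := φ.isLUB_image'.2 hlub
  rw [map_top] at hlub'
  have hdir' : DirectedOn (· ≤ ·) (φ '' s) := by
    rintro _ ⟨a, ha, rfl⟩ _ ⟨b, hb, rfl⟩
    obtain ⟨c, hc, h1, h2⟩ := hdir a ha b hb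
    exact ⟨φ c, ⟨c, hc, rfl⟩, φ.monotone h1, φ.monotone h2⟩
  rw [CompleteLattice.isCompactElement_iff_le_of_directed_sSup_le] at hc
  obtain ⟨_, ⟨x, hx, rfl⟩, hle⟩ := hc _ (hne.image φ) hdir' hlub'.sSup_eq.ge
  have : φ x = φ ⊤ := by rw [map_top]; exact top_le_iff.1 hle
  rwa [← φ.injective this]

/-- Lift the identity of `C` along the free cover `A^(C) → C` on the span of `F`; the coordinates of
the lift are the functionals. -/
theorem exists_dual_basis {A : Type u} [Ring A] {C : Type u} [AddCommGroup C] [Module A C]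
    (hC : IsWeaklyLocallyProjective (ModuleCat.of A C)) (F : Finset C) :
    ∃ (s : Finset C) (f : C → C →ₗ[A] A), ∀ c ∈ F, ∑ d ∈ s, f d c • d = c := by
  classical
  let E := Submodule.span A (F : Set C)
  let g : ModuleCat.of A (C →₀ A) ⟶ ModuleCat.of A C :=
    ModuleCat.ofHom (Finsupp.linearCombination A id)
  have hg : Epi g := (ModuleCat.epi_iff_surjective g).2
    (Finsupp.linearCombination_id_surjective A C)
  have hi : Mono (ModuleCat.ofHom E.subtype) :=
    (ModuleCat.mono_iff_injective _).2 E.injective_subtype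
  have : Module.Finite A E := Module.Finite.span_finset A F
  obtain ⟨h, hh⟩ := hC (ModuleCat.of A E) _ _ (ModuleCat.ofHom E.subtype) (𝟙 _) g hi hg
    isFinGenObj_of_fg
  refine ⟨F.biUnion fun c => (h.hom c).support, fun d => (Finsupp.lapply d).comp h.hom,
    fun c hc => ?_⟩
  have h1 : Finsupp.linearCombination A id (h.hom c) = c :=
    ConcreteCategory.congr_hom hh (⟨c, Submodule.subset_span hc⟩ : E)
  rw [Finsupp.linearCombination_apply, Finsupp.sum_of_support_subset _
    (Finset.subset_biUnion_of_mem (fun c => (h.hom c).support) hc) _ (by simp)] at h1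
  exact h1

end LocallyProjective

/-! ### Tensors are determined by their contractions -/

section Contract

variable {A : Type u} [Ring A] {M N : Type u} [AddCommGroup M] [Module Aᵐᵒᵖ M] [AddCommGroup N]
  [Module A N]

theorem tmk_zero_left (n : N) : tmk A (0 : M) n = 0 :=
  congrArg (· n) (map_zero (tmkHom A (M := M)))

theorem exists_finset_contract_congr (z : NCTensor A M N) :
    ∃ F : Finset N, ∀ f g : N →ₗ[A] A, (∀ c ∈ F, f c = g c) → contract M f z = contract M g z := by
  classical
  induction z using tensor_induction with
  | h0 => exact ⟨∅, fun f g _ => by rw [map_zero, map_zero]⟩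
  | h1 m n => exact ⟨{n}, fun f g h => by simp [h n (by simp)]⟩
  | h2 x y hx hy =>
    obtain ⟨F, hF⟩ := hx
    obtain ⟨G, hG⟩ := hy
    exact ⟨F ∪ G, fun f g h => by
      rw [map_add, map_add, hF f g fun c hc => h c (Finset.mem_union_left _ hc),
        hG f g fun c hc => h c (Finset.mem_union_right _ hc)]⟩

/-- Both sides send `m ⊗ n` to `g(m) f(n)`. This exchange turns the equation defining `Q` into
`*C`-linearity. -/
theorem map_contract (g : M →ₗ[Aᵐᵒᵖ] A) (f : N →ₗ[A] A) (z : NCTensor A M N) :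
    g (contract M f z) = f (contractLeft N g z) := by
  induction z using tensor_induction with
  | h0 => simp only [map_zero]
  | h1 m n => rw [contract_tmk, contractLeft_tmk, map_smul, map_smul]; rfl
  | h2 x y hx hy => simp only [map_add, hx, hy]

theorem exists_finset_lTensor_eq (z : NCTensor A M N) :
    ∃ F : Finset N, ∀ φ : N →ₗ[A] N, (∀ c ∈ F, φ c = c) → lTensor M φ z = z := by
  classical
  induction z using tensor_induction with
  | h0 => exact ⟨∅, fun φ _ => map_zero _⟩
  | h1 m n => exact ⟨{n}, fun φ h => by simp [h n (by simp)]⟩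
  | h2 x y hx hy =>
    obtain ⟨F, hF⟩ := hx
    obtain ⟨G, hG⟩ := hy
    exact ⟨F ∪ G, fun φ h => by
      rw [map_add, hF φ fun c hc => h c (Finset.mem_union_left _ hc),
        hG φ fun c hc => h c (Finset.mem_union_right _ hc)]⟩

theorem sum_tmk_contract (s : Finset N) (f : N → N →ₗ[A] A) (φ : N →ₗ[A] N)
    (hφ : ∀ c, φ c = ∑ d ∈ s, f d c • d) (z : NCTensor A M N) :
    ∑ d ∈ s, tmk A (contract M (f d) z) d = lTensor M φ z := by
  induction z using tensor_induction with
  | h0 => simp only [map_zero, tmk_zero_left, Finset.sum_const_zero]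
  | h1 m n =>
    rw [lTensor_tmk, hφ]
    change _ = tmkHom A m _
    rw [map_sum]
    refine Finset.sum_congr rfl fun d _ => ?_
    rw [contract_tmk, tmk_balanced]; rfl
  | h2 x y hx hy =>
    rw [map_add, ← hx, ← hy, ← Finset.sum_add_distrib]
    exact Finset.sum_congr rfl fun d _ => by rw [map_add, tmk_add_left]

theorem ext_dual (hN : IsWeaklyLocallyProjective (ModuleCat.of A N)) {c d : N}
    (h : ∀ f : N →ₗ[A] A, f c = f d) : c = d := by
  obtain ⟨s, f, hs⟩ := exists_dual_basis hN {c - d}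
  rw [← sub_eq_zero, ← hs (c - d) (Finset.mem_singleton_self _)]
  exact Finset.sum_eq_zero fun e _ => by rw [map_sub, h, sub_self, zero_smul]

/-- Only finitely many elements of `N` occur in `z`, and a dual basis for them reproduces `z`. The
left factors are contractions of `z`, so they remain in any submodule containing those contractions.
-/
theorem exists_eq_sum_tmk_contract (hN : IsWeaklyLocallyProjective (ModuleCat.of A N))
    (z : NCTensor A M N) :
    ∃ (s : Finset N) (f : N → N →ₗ[A] A), z = ∑ d ∈ s, tmk A (contract M (f d) z) d := by
  obtain ⟨F, hF⟩ := exists_finset_lTensor_eq z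
  obtain ⟨s, f, hs⟩ := exists_dual_basis hN F
  let φ : N →ₗ[A] N := ∑ d ∈ s, (f d).smulRight d
  have hφ : ∀ c, φ c = ∑ d ∈ s, f d c • d := fun c => by simp [φ]
  refine ⟨s, f, ?_⟩
  rw [sum_tmk_contract s f φ hφ, hF φ fun c hc => by rw [hφ, hs c hc]]

theorem tensor_ext_contract (hN : IsWeaklyLocallyProjective (ModuleCat.of A N))
    {z w : NCTensor A M N} (h : ∀ f : N →ₗ[A] A, contract M f z = contract M f w) : z = w := by
  rw [← sub_eq_zero]
  obtain ⟨s, f, hs⟩ := exists_eq_sum_tmk_contract hN (z - w)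
  rw [hs]
  refine Finset.sum_eq_zero fun d _ => ?_
  rw [map_sub, h, sub_self, tmk_zero_left]

end Contract

/-! ### Comodules as rational modules over the left dual -/

section Rational

variable {A : Type u} [Ring A] {C : Type u} [AddCommGroup C] [Module A C] [Module Aᵐᵒᵖ C]
  [SMulCommClass A Aᵐᵒᵖ C] [Coring A C]

theorem hit_conv (f g : LeftDual A C) (c : C) : hit (conv f g) c = hit g (hit f c) := by
  change contract C (g.comp (hit f)) _ = contract C g (Coring.comul (hit f c))
  rw [comul_hit, contract_lTensor]

theorem conv_assoc (f g h : LeftDual A C) : conv (conv f g) h = conv f (conv g h) :=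
  LinearMap.ext fun c => congrArg h (hit_conv f g c)

theorem counit_contract (f : LeftDual A C) (c : C) :
    Coring.counit (A := A) (contract C f (Coring.comul (A := A) c)) = f c := by
  conv_rhs => rw [← Coring.counit_left (A := A) c]
  rw [← map_contract]
  rfl

theorem conv_smul_counit (f : LeftDual A C) (a : Aᵐᵒᵖ) :
    conv f (a • Coring.counit (A := A) (C := C)) = a • f := by
  ext c
  change a • Coring.counit (A := A) (contract C f _) = a • f c
  rw [counit_contract]

theorem smul_counit_conv (f : LeftDual A C) (a : Aᵐᵒᵖ) (c : C) :
    conv (a • Coring.counit (A := A) (C := C)) f c = f (a • c) := by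
  change f (contract C (a • Coring.counit (A := A) (C := C)) _) = _
  rw [contract_op_smul_fun, Coring.counit_right]

/-- The right action of `a` on `C` is the hit action of `a • ε`, so `A`-linearity of a coaction
becomes a case of associativity of the `*C`-action. -/
theorem contract_op_smul {M : Type u} [AddCommGroup M] [Module Aᵐᵒᵖ M] (a : Aᵐᵒᵖ)
    (f : LeftDual A C) (z : NCTensor A M C) : contract M f (a • z) =
      contract M (conv (a • Coring.counit (A := A) (C := C)) f) z := by
  induction z using tensor_induction with
  | h0 => rw [smul_zero, map_zero, map_zero]
  | h1 m n => rw [op_smul_tmk, contract_tmk, contract_tmk, smul_counit_conv]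
  | h2 x y hx hy => rw [smul_add, map_add, map_add, hx, hy]

theorem dualAct_dualAct (S : Comod A C) (x : S) (f g : LeftDual A C) :
    dualAct S (dualAct S x f) g = dualAct S x (conv f g) := by
  rw [dualAct, coact_dualAct, contract_lTensor]; rfl

theorem dualAct_smul_counit (S : Comod A C) (x : S) (a : Aᵐᵒᵖ) :
    dualAct S x (a • Coring.counit (A := A) (C := C)) = a • x := by
  rw [dualAct, contract_op_smul_fun, S.str.counit]

theorem dualAct_add (S : Comod A C) (x y : S) (f : LeftDual A C) :
    dualAct S (x + y) f = dualAct S x f + dualAct S y f := by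
  simp only [dualAct, map_add]

theorem dualAct_zero (S : Comod A C) (f : LeftDual A C) : dualAct S 0 f = 0 := by
  simp only [dualAct, map_zero]

theorem dualAct_sub (S : Comod A C) (x y : S) (f : LeftDual A C) :
    dualAct S (x - y) f = dualAct S x f - dualAct S y f := by
  simp only [dualAct, map_sub]

theorem dualAct_add_fun (S : Comod A C) (x : S) (f g : LeftDual A C) :
    dualAct S x (f + g) = dualAct S x f + dualAct S x g := contract_add_fun f g _

/-- `f ↦ x · f` as an additive map. -/
def dualActHom (S : Comod A C) (x : S) : LeftDual A C →+ S :=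
  AddMonoidHom.mk' (dualAct S x) (dualAct_add_fun S x)

theorem Comod.Hom.map_dualAct {M N : Comod A C} (φ : Comod.Hom M N) (x : M) (f : LeftDual A C) :
    φ.toLin (dualAct M x f) = dualAct N (φ.toLin x) f := by
  rw [dualAct, dualAct, φ.colinear, contract_rTensor]

/-- Over a weakly locally projective coring, a rational `*C`-action comes from a comodule
structure. -/
theorem exists_comoduleStr (hC : IsWeaklyLocallyProjective (ModuleCat.of A C)) {M : Type u}
    [AddCommGroup M] [Module Aᵐᵒᵖ M] (act : M → LeftDual A C → M)
    (hadd : ∀ x y f, act (x + y) f = act x f + act y f)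
    (hsmul : ∀ x (a : Aᵐᵒᵖ), act x (a • Coring.counit (A := A) (C := C)) = a • x)
    (hassoc : ∀ x f g, act (act x f) g = act x (conv f g))
    (hrat : ∀ x, ∃ z : NCTensor A M C, ∀ f, contract M f z = act x f) :
    ∃ ρ : ComoduleStr A C M, ∀ x f, contract M f (ρ.coact x) = act x f := by
  -- The choice is forced, since a tensor is determined by its contractions; every comodule axiom is
  -- then checked after contracting.
  choose ρ hρ using hrat
  refine ⟨⟨⟨⟨ρ, fun x y => ?_⟩, fun a x => ?_⟩, fun x => ?_, fun x => ?_⟩, hρ⟩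
  · exact tensor_ext_contract hC fun f => by rw [map_add, hρ, hρ, hρ, hadd]
  · exact tensor_ext_contract hC fun f => by
      change contract M f (ρ (a • x)) = contract M f (a • ρ x)
      rw [contract_op_smul, hρ, hρ, ← hassoc, hsmul]
  · exact tensor_ext_contract hC fun f => tensor_ext_contract hC fun g => by
      rw [contract_tassoc_comul, contract_rTensor, contract_lTensor]
      change contract M (conv f g) (ρ x) = contract M g (ρ (contract M f (ρ x)))
      rw [hρ, hρ, hρ, hassoc]
  · change contract M _ (ρ x) = x
    have := hsmul x 1
    rwa [one_smul, one_smul, ← hρ] at this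

/-- A right `A`-linear map compatible with the `*C`-actions is colinear. -/
def Comod.Hom.ofDualAct (hC : IsWeaklyLocallyProjective (ModuleCat.of A C)) {M N : Comod A C}
    (φ : M →ₗ[Aᵐᵒᵖ] N) (h : ∀ x f, φ (dualAct M x f) = dualAct N (φ x) f) : Comod.Hom M N :=
  ⟨φ, fun x => tensor_ext_contract hC fun f => by rw [contract_rTensor]; exact (h x f).symm⟩

/-- A submodule of a comodule stable under the action of `*C`. -/
def IsInvariant {M : Comod A C} (K : Submodule Aᵐᵒᵖ M) : Prop :=
  ∀ x ∈ K, ∀ f : LeftDual A C, dualAct M x f ∈ K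

theorem exists_subcomodule (hC : IsWeaklyLocallyProjective (ModuleCat.of A C)) {M : Comod A C}
    {K : Submodule Aᵐᵒᵖ M} (hK : IsInvariant K) :
    ∃ ρ : ComoduleStr A C K, ∀ (x : K) f, (contract K f (ρ.coact x) : M) = dualAct M x f := by
  obtain ⟨ρ, hρ⟩ := exists_comoduleStr hC (M := K) (fun x f => ⟨dualAct M x f, hK x x.2 f⟩)
    (fun x y f => Subtype.ext (dualAct_add M x y f))
    (fun x a => Subtype.ext (dualAct_smul_counit M x a))
    (fun x f g => Subtype.ext (dualAct_dualAct M x f g))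
    (fun x => by
      -- The left factors `x · f_d` lie in `K`, so this expansion already defines a tensor in `K ⊗
      -- C`; injectivity of `K ⊗ C → M ⊗ C` is not needed.
      obtain ⟨s, f, hs⟩ := exists_eq_sum_tmk_contract hC (M.str.coact x)
      refine ⟨∑ d ∈ s, tmk A ⟨dualAct M x (f d), hK x x.2 (f d)⟩ d, fun g => Subtype.ext ?_⟩
      change K.subtype _ = contract M g (M.str.coact x)
      rw [hs, ← contract_rTensor, map_sum, map_sum, map_sum]
      exact Finset.sum_congr rfl fun d _ => by rw [rTensor_tmk]; rfl)
  exact ⟨ρ, fun x f => congrArg Subtype.val (hρ x f)⟩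

/-- An invariant submodule as a comodule. -/
noncomputable def subcomod (hC : IsWeaklyLocallyProjective (ModuleCat.of A C)) {M : Comod A C}
    {K : Submodule Aᵐᵒᵖ M} (hK : IsInvariant K) : Comod A C :=
  ⟨K, (exists_subcomodule hC hK).choose⟩

/-- The inclusion of an invariant submodule. -/
noncomputable def subcomodι (hC : IsWeaklyLocallyProjective (ModuleCat.of A C)) {M : Comod A C}
    {K : Submodule Aᵐᵒᵖ M} (hK : IsInvariant K) : subcomod hC hK ⟶ M :=
  Comod.Hom.ofDualAct hC K.subtype fun x f => (exists_subcomodule hC hK).choose_spec x f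

/-- A colinear map with values in an invariant submodule factors through it. -/
noncomputable def subcomodLift (hC : IsWeaklyLocallyProjective (ModuleCat.of A C))
    {M N : Comod A C} {K : Submodule Aᵐᵒᵖ M} (hK : IsInvariant K) (φ : N ⟶ M)
    (h : ∀ x, φ.toLin x ∈ K) : N ⟶ subcomod hC hK :=
  Comod.Hom.ofDualAct hC (φ.toLin.codRestrict K h) fun x f => Subtype.ext <| by
    refine Eq.trans (Comod.Hom.map_dualAct φ x f) (Eq.symm ?_)
    exact (exists_subcomodule hC hK).choose_spec ⟨φ.toLin x, h x⟩ f

theorem exists_quotient_comodule (hC : IsWeaklyLocallyProjective (ModuleCat.of A C))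
    {M : Comod A C} {K : Submodule Aᵐᵒᵖ M} (hK : IsInvariant K) :
    ∃ ρ : ComoduleStr A C (M ⧸ K), ∀ (x : M) f,
      contract (M ⧸ K) f (ρ.coact (K.mkQ x)) = K.mkQ (dualAct M x f) := by
  have hs := K.mkQ_surjective
  obtain ⟨act, hact⟩ : ∃ act : M ⧸ K → LeftDual A C → M ⧸ K,
      ∀ x f, act (K.mkQ x) f = K.mkQ (dualAct M x f) := by
    -- Invariance of `K` makes the action independent of the chosen representative.
    refine ⟨fun y f => K.mkQ (dualAct M (Function.surjInv hs y) f), fun x f => ?_⟩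
    have h' := (Submodule.Quotient.eq K).1 (Function.surjInv_eq hs (K.mkQ x))
    have := hK _ h' f
    rw [dualAct_sub] at this
    exact (Submodule.Quotient.eq K).2 this
  obtain ⟨ρ, hρ⟩ := exists_comoduleStr hC act
    (fun x y f => by
      obtain ⟨x, rfl⟩ := hs x
      obtain ⟨y, rfl⟩ := hs y
      rw [← map_add, hact, hact, hact, dualAct_add, map_add])
    (fun x a => by
      obtain ⟨x, rfl⟩ := hs x
      rw [hact, dualAct_smul_counit, map_smul])
    (fun x f g => by
      obtain ⟨x, rfl⟩ := hs x
      rw [hact, hact, hact, dualAct_dualAct])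
    (fun x => by
      obtain ⟨x, rfl⟩ := hs x
      exact ⟨rTensor C K.mkQ (M.str.coact x), fun f => by rw [hact, contract_rTensor]; rfl⟩)
  exact ⟨ρ, fun x f => by rw [hρ, hact]⟩

/-- The quotient of a comodule by an invariant submodule. -/
noncomputable def quotComod (hC : IsWeaklyLocallyProjective (ModuleCat.of A C)) {M : Comod A C}
    {K : Submodule Aᵐᵒᵖ M} (hK : IsInvariant K) : Comod A C :=
  ⟨M ⧸ K, (exists_quotient_comodule hC hK).choose⟩

/-- The projection onto the quotient by an invariant submodule. -/
noncomputable def quotComodπ (hC : IsWeaklyLocallyProjective (ModuleCat.of A C)) {M : Comod A C}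
    {K : Submodule Aᵐᵒᵖ M} (hK : IsInvariant K) : M ⟶ quotComod hC hK :=
  Comod.Hom.ofDualAct hC K.mkQ fun x f => ((exists_quotient_comodule hC hK).choose_spec x f).symm

theorem exists_finsupp_comodule (hC : IsWeaklyLocallyProjective (ModuleCat.of A C))
    (ι : Type u) (M : Comod A C) :
    ∃ ρ : ComoduleStr A C (ι →₀ M), ∀ (x : ι →₀ M) f,
      contract (ι →₀ M) f (ρ.coact x) = x.mapRange (fun m => dualAct M m f) (dualAct_zero M f) := by
  classical
  exact exists_comoduleStr hC
    (fun (x : ι →₀ M) f => x.mapRange (fun m => dualAct M m f) (dualAct_zero M f))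
    (fun x y f => Finsupp.ext fun i => by simp [dualAct_add])
    (fun x a => Finsupp.ext fun i => by simp [dualAct_smul_counit])
    (fun x f g => Finsupp.ext fun i => by simp [dualAct_dualAct])
    (fun x => by
      -- Rationality is inherited by sums, so it suffices to treat elements supported at one index.
      induction x using Finsupp.induction_linear with
      | zero => exact ⟨0, fun f => by simp⟩
      | add x y hx hy =>
        obtain ⟨z, hz⟩ := hx
        obtain ⟨w, hw⟩ := hy
        exact ⟨z + w, fun f => by
          rw [map_add, hz, hw]
          exact Finsupp.ext fun i => by simp [dualAct_add]⟩
      | single i m =>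
        exact ⟨rTensor C (Finsupp.lsingle i) (M.str.coact m), fun f => by
          rw [contract_rTensor, Finsupp.mapRange_single]; rfl⟩)

/-- The direct sum of copies of a comodule. -/
noncomputable def finsuppComod (hC : IsWeaklyLocallyProjective (ModuleCat.of A C)) (ι : Type u)
    (M : Comod A C) : Comod A C :=
  ⟨ι →₀ M, (exists_finsupp_comodule hC ι M).choose⟩

theorem dualAct_finsuppComod (hC : IsWeaklyLocallyProjective (ModuleCat.of A C))
    (ι : Type u) (M : Comod A C) (x : ι →₀ M) (f : LeftDual A C) :
    dualAct (finsuppComod hC ι M) x f =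
      x.mapRange (fun m => dualAct M m f) (dualAct_zero M f) :=
  (exists_finsupp_comodule hC ι M).choose_spec x f

/-- The colinear map on a direct sum given by colinear maps on the summands. -/
noncomputable def finsuppComodLift (hC : IsWeaklyLocallyProjective (ModuleCat.of A C))
    {ι : Type u} {M N : Comod A C} (φ : ι → (M ⟶ N)) : finsuppComod hC ι M ⟶ N :=
  Comod.Hom.ofDualAct hC (Finsupp.lsum ℕ (fun i => (φ i).toLin) : (ι →₀ M) →ₗ[Aᵐᵒᵖ] N)
    fun x f => by
      let g : N →+ N := AddMonoidHom.mk' (dualAct N · f) fun y z => dualAct_add N y z f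
      refine (congrArg (Finsupp.lsum ℕ fun i => (φ i).toLin)
        (dualAct_finsuppComod hC ι M x f)).trans ?_
      refine (Finsupp.sum_mapRange_index fun i => map_zero (φ i).toLin).trans ?_
      refine Eq.trans ?_ (map_finsuppSum g (x : ι →₀ M) fun i => (φ i).toLin).symm
      exact Finsupp.sum_congr fun i _ => Comod.Hom.map_dualAct (φ i) _ f

end Rational

/-! ### The rational part of the dual and density -/

section RatDual

variable {A : Type u} [Ring A] {C : Type u} [AddCommGroup C] [Module A C] [Module Aᵐᵒᵖ C]
  [SMulCommClass A Aᵐᵒᵖ C] [Coring A C]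

theorem conv_add (f g h : LeftDual A C) : conv (f + g) h = conv f h + conv g h := by
  ext c
  change h (contract C (f + g) _) = h (contract C f _) + h (contract C g _)
  rw [contract_add_fun, map_add]

variable (A C) in
/-- The elements `f` of `*C` for which `g ↦ f * g` is induced by an element of `*C ⊗ C`. -/
def rationalElements : Submodule Aᵐᵒᵖ (LeftDual A C) where
  carrier := {f | ∃ z : NCTensor A (LeftDual A C) C, ∀ g, contract (LeftDual A C) g z = conv f g}
  add_mem' := by
    rintro f g ⟨z, hz⟩ ⟨w, hw⟩
    exact ⟨z + w, fun h => by rw [map_add, hz, hw, conv_add]⟩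
  zero_mem' := ⟨0, fun g => by
    have h := conv_add (0 : LeftDual A C) 0 g
    rw [add_zero, left_eq_add] at h
    rw [map_zero, h]⟩
  smul_mem' := by
    rintro a f ⟨z, hz⟩
    exact ⟨a • z, fun g => by rw [contract_op_smul, hz, ← conv_assoc, conv_smul_counit]⟩

theorem conv_mem_rationalElements {f : LeftDual A C} (hf : f ∈ rationalElements A C)
    (g : LeftDual A C) : conv f g ∈ rationalElements A C := by
  obtain ⟨z, hz⟩ := hf
  exact ⟨lTensor _ (hit g) z, fun h => by rw [contract_lTensor, conv_assoc, ← hz]; rfl⟩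

theorem exists_rationalElements_comodule (hC : IsWeaklyLocallyProjective (ModuleCat.of A C)) :
    ∃ ρ : ComoduleStr A C (rationalElements A C), ∀ (n : rationalElements A C) f,
      conv (n : LeftDual A C) f = (contract (rationalElements A C) f (ρ.coact n) :
        rationalElements A C) := by
  obtain ⟨ρ, hρ⟩ := exists_comoduleStr hC (M := rationalElements A C)
    (fun n f => ⟨conv n.1 f, conv_mem_rationalElements n.2 f⟩)
    (fun x y f => Subtype.ext (by simp only [Submodule.coe_add, conv_add]))
    (fun x a => Subtype.ext (by
      rw [Submodule.coe_smul]
      exact conv_smul_counit x.1 a))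
    (fun x f g => Subtype.ext (conv_assoc x.1 f g))
    (fun x => by
      obtain ⟨z, hz⟩ := x.2
      obtain ⟨s, f, hs⟩ := exists_eq_sum_tmk_contract hC z
      refine ⟨∑ d ∈ s, tmk A ⟨conv x.1 (f d), conv_mem_rationalElements x.2 _⟩ d,
        fun g => Subtype.ext ?_⟩
      refine (contract_rTensor (M := rationalElements A C) (M' := LeftDual A C)
        (rationalElements A C).subtype g _).symm.trans ?_
      change _ = conv x.1 g
      rw [← hz, hs, map_sum, map_sum, map_sum]
      exact Finset.sum_congr rfl fun d _ => by rw [rTensor_tmk, hz (f d)]; rfl)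
  exact ⟨ρ, fun n f => (congrArg Subtype.val (hρ n f)).symm⟩

/-- A supremum of rational submodules need not be visibly rational. Here it is, because the rational
elements themselves form a member of the family that contains all others. -/
theorem ratDual_eq (hC : IsWeaklyLocallyProjective (ModuleCat.of A C)) :
    ratDual A C = rationalElements A C := by
  refine le_antisymm (sSup_le ?_) (le_sSup (exists_rationalElements_comodule hC))
  rintro N ⟨ρ, hρ⟩ n hn
  exact ⟨rTensor C N.subtype (ρ.coact ⟨n, hn⟩), fun g => by
    rw [contract_rTensor]; exact (hρ ⟨n, hn⟩ g).symm⟩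

theorem exists_ratDual_comodule (hC : IsWeaklyLocallyProjective (ModuleCat.of A C)) :
    ∃ ρ : ComoduleStr A C (ratDual A C), ∀ (n : ratDual A C) f,
      conv (n : LeftDual A C) f = (contract (ratDual A C) f (ρ.coact n) : ratDual A C) := by
  rw [ratDual_eq hC]
  exact exists_rationalElements_comodule hC

/-- `Rat(*C)` as a comodule. -/
noncomputable def ratComod (hC : IsWeaklyLocallyProjective (ModuleCat.of A C)) : Comod A C :=
  ⟨ratDual A C, (exists_ratDual_comodule hC).choose⟩

theorem dualAct_ratComod (hC : IsWeaklyLocallyProjective (ModuleCat.of A C)) (n : ratDual A C)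
    (f : LeftDual A C) :
    (dualAct (ratComod hC) n f : ratDual A C).1 = conv n.1 f :=
  ((exists_ratDual_comodule hC).choose_spec n f).symm

theorem exists_mem_ratDual_eqOn
    (hdense : @Dense (LeftDual A C) (finiteTopology A C) (ratDual A C)) (f : LeftDual A C)
    (F : Finset C) : ∃ r ∈ ratDual A C, ∀ c ∈ F, r c = f c := by
  let _ : TopologicalSpace A := ⊥
  have : DiscreteTopology A := ⟨rfl⟩
  let _ := finiteTopology A C
  -- The functionals that agree with `f` on `F` form an open neighbourhood of `f`.
  have hU : IsOpen ((fun (f : LeftDual A C) c => f c) ⁻¹' (Set.pi (F : Set C) fun c => {f c})) :=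
    isOpen_induced (isOpen_set_pi F.finite_toSet fun c _ => isOpen_discrete _)
  obtain ⟨r, hr, hr'⟩ := hdense.inter_open_nonempty _ hU ⟨f, fun c _ => rfl⟩
  exact ⟨r, hr', fun c hc => hr c hc⟩

/-- The counit fixes `x`, and the action on `x` depends only on finitely many values of a
functional; density replaces the counit by a rational element with the same values. -/
theorem exists_ratDual_dualAct_eq
    (hdense : @Dense (LeftDual A C) (finiteTopology A C) (ratDual A C)) (M : Comod A C) (x : M) :
    ∃ r ∈ ratDual A C, dualAct M x r = x := by
  obtain ⟨F, hF⟩ := exists_finset_contract_congr (M.str.coact x)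
  obtain ⟨r, hr, h⟩ := exists_mem_ratDual_eqOn hdense (Coring.counit (A := A) (C := C)) F
  exact ⟨r, hr, (hF _ _ h).trans (M.str.counit x)⟩

end RatDual

end GaloisComodule

namespace GaloisComodule

/-! ### Monos, epis and finitely generated objects among comodules -/

section Category

open CategoryTheory

variable {A : Type u} [Ring A] {C : Type u} [AddCommGroup C] [Module A C] [Module Aᵐᵒᵖ C]
  [SMulCommClass A Aᵐᵒᵖ C] [Coring A C]

/-- The zero map of comodules. -/
def Comod.Hom.zero (hC : IsWeaklyLocallyProjective (ModuleCat.of A C)) (M N : Comod A C) :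
    M ⟶ N :=
  Comod.Hom.ofDualAct hC 0 fun _ f => (dualAct_zero N f).symm

/-- The sum of two colinear maps. -/
def Comod.Hom.add (hC : IsWeaklyLocallyProjective (ModuleCat.of A C)) {M N : Comod A C}
    (φ ψ : M ⟶ N) : M ⟶ N :=
  Comod.Hom.ofDualAct hC (φ.toLin + ψ.toLin) fun x f => by
    rw [LinearMap.add_apply, LinearMap.add_apply, Comod.Hom.map_dualAct,
      Comod.Hom.map_dualAct, dualAct_add]

theorem Comod.hom_congr {M N : Comod A C} {φ ψ : M ⟶ N} (h : φ = ψ) (x : M) :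
    φ.toLin x = ψ.toLin x := by rw [h]

theorem Comod.mono_of_injective {M N : Comod A C} (φ : M ⟶ N)
    (h : Function.Injective φ.toLin) : Mono φ :=
  ⟨fun _ _ hαβ => Comod.Hom.ext (LinearMap.ext fun x => h (Comod.hom_congr hαβ x))⟩

theorem Comod.epi_of_surjective {M N : Comod A C} (φ : M ⟶ N)
    (h : Function.Surjective φ.toLin) : Epi φ :=
  ⟨fun _ _ hαβ => Comod.Hom.ext (LinearMap.ext fun y => by
    obtain ⟨x, rfl⟩ := h y
    exact Comod.hom_congr hαβ x)⟩

/-- The kernel is a subcomodule, and its inclusion and the zero map have the same composite with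
`φ`. -/
theorem Comod.injective_of_mono (hC : IsWeaklyLocallyProjective (ModuleCat.of A C))
    {M N : Comod A C} (φ : M ⟶ N) [Mono φ] : Function.Injective φ.toLin := by
  have hK : IsInvariant (LinearMap.ker φ.toLin) := fun x hx f => by
    rw [LinearMap.mem_ker] at hx ⊢
    rw [Comod.Hom.map_dualAct, hx, dualAct_zero]
  have h : (subcomodι hC hK) = Comod.Hom.zero hC _ _ :=
    (cancel_mono φ).1 (Comod.Hom.ext (LinearMap.ext fun x =>
      (LinearMap.mem_ker.1 x.2).trans (map_zero φ.toLin).symm))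
  rw [← LinearMap.ker_eq_bot, eq_bot_iff]
  exact fun x hx => Comod.hom_congr h ⟨x, hx⟩

theorem isInvariant_range {M N : Comod A C} (φ : M ⟶ N) :
    IsInvariant (LinearMap.range φ.toLin) := by
  rintro _ ⟨x, rfl⟩ f
  exact ⟨dualAct M x f, Comod.Hom.map_dualAct φ x f⟩

/-- The projection onto the cokernel and the zero map agree after composing with `φ`. -/
theorem Comod.surjective_of_epi (hC : IsWeaklyLocallyProjective (ModuleCat.of A C))
    {M N : Comod A C} (φ : M ⟶ N) [Epi φ] : Function.Surjective φ.toLin := by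
  have hK := isInvariant_range φ
  have h : quotComodπ hC hK = Comod.Hom.zero hC _ _ :=
    (cancel_epi φ).1 (Comod.Hom.ext (LinearMap.ext fun x =>
      (Submodule.Quotient.mk_eq_zero _).2 (LinearMap.mem_range_self φ.toLin x)))
  exact fun y => (Submodule.Quotient.mk_eq_zero _).1 (Comod.hom_congr h y)

theorem Comod.isIso_of_bijective {M N : Comod A C} (φ : M ⟶ N)
    (h : Function.Bijective φ.toLin) : IsIso φ := by
  let e := LinearEquiv.ofBijective φ.toLin h
  have h1 : e.symm.toLinearMap.comp φ.toLin = LinearMap.id :=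
    LinearMap.ext fun x => e.symm_apply_apply x
  have h2 : φ.toLin.comp e.symm.toLinearMap = LinearMap.id :=
    LinearMap.ext fun x => e.apply_symm_apply x
  refine ⟨⟨e.symm.toLinearMap, fun y => ?_⟩, Comod.Hom.ext h1, Comod.Hom.ext h2⟩
  obtain ⟨x, rfl⟩ := h.2 y
  rw [φ.colinear, ← rTensor_comp, h1, rTensor_id]
  exact congrArg _ (e.symm_apply_apply x)

theorem subobject_eq_top_of_surjective (hC : IsWeaklyLocallyProjective (ModuleCat.of A C))
    {M : Comod A C} (P : Subobject M) (h : Function.Surjective P.arrow.toLin) : P = ⊤ := by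
  have := Comod.isIso_of_bijective P.arrow ⟨Comod.injective_of_mono hC P.arrow, h⟩
  exact Subobject.eq_top_of_isIso_arrow P

instance subcomodι_mono (hC : IsWeaklyLocallyProjective (ModuleCat.of A C)) {M : Comod A C}
    {K : Submodule Aᵐᵒᵖ M} (hK : IsInvariant K) :
    Mono (subcomodι hC hK) :=
  Comod.mono_of_injective _ K.injective_subtype

theorem eq_top_of_mk_subcomodι_eq_top (hC : IsWeaklyLocallyProjective (ModuleCat.of A C))
    {M : Comod A C} {K : Submodule Aᵐᵒᵖ M} (hK : IsInvariant K)
    (h : Subobject.mk (subcomodι hC hK) = ⊤) : K = ⊤ := by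
  have := (Subobject.isIso_iff_mk_eq_top _).2 h
  rw [eq_top_iff]
  intro x _
  obtain ⟨y, rfl⟩ := Comod.surjective_of_epi hC (subcomodι hC hK) x
  exact y.2

/-- The only subcomodule of `M` that contains `F` is `M`. -/
def Generates {M : Comod A C} (F : Set M) : Prop :=
  ∀ K : Submodule Aᵐᵒᵖ M, IsInvariant K → F ⊆ K → K = ⊤

/-- The subcomodule generated by a set. -/
def generated {M : Comod A C} (F : Set M) : Submodule Aᵐᵒᵖ M :=
  sInf {K | IsInvariant K ∧ F ⊆ K}

theorem subset_generated {M : Comod A C} (F : Set M) : F ⊆ generated F := fun _ hx =>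
  Submodule.mem_sInf.2 fun _ hK => hK.2 hx

theorem generated_le {M : Comod A C} {F : Set M} {K : Submodule Aᵐᵒᵖ M} (hK : IsInvariant K)
    (h : F ⊆ K) : generated F ≤ K := sInf_le ⟨hK, h⟩

theorem isInvariant_generated {M : Comod A C} (F : Set M) : IsInvariant (generated F) :=
  fun x hx f => Submodule.mem_sInf.2 fun K hK => hK.1 x (Submodule.mem_sInf.1 hx K hK) f

/-- A directed union of subcomodules is a subcomodule. If it is everything, one member already
contains the finite generating set. -/
theorem isFinGenObj_of_generates (hC : IsWeaklyLocallyProjective (ModuleCat.of A C))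
    {M : Comod A C} (F : Finset M) (hF : Generates (F : Set M)) : IsFinGenObj M := by
  intro s hne hdir hlub
  let r : Subobject M → Submodule Aᵐᵒᵖ M := fun P => LinearMap.range P.arrow.toLin
  have hr : ∀ P Q, P ≤ Q → r P ≤ r Q := by
    rintro P Q hPQ _ ⟨x, rfl⟩
    exact ⟨(Subobject.ofLE P Q hPQ).toLin x, Comod.hom_congr (Subobject.ofLE_arrow hPQ) x⟩
  have hdir' : DirectedOn (· ≤ ·) (r '' s) := by
    rintro _ ⟨P, hP, rfl⟩ _ ⟨Q, hQ, rfl⟩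
    obtain ⟨T, hT, h1, h2⟩ := hdir P hP Q hQ
    exact ⟨r T, ⟨T, hT, rfl⟩, hr _ _ h1, hr _ _ h2⟩
  let U := sSup (r '' s)
  have hU : ∀ x, x ∈ U ↔ ∃ P ∈ s, x ∈ r P := fun x => by
    rw [Submodule.mem_sSup_of_directed (hne.image r) hdir']
    simp
  have hinv : IsInvariant U := fun x hx f => by
    obtain ⟨P, hP, h⟩ := (hU x).1 hx
    exact (hU _).2 ⟨P, hP, isInvariant_range P.arrow x h f⟩
  -- The union is an upper bound of the family, so it dominates the least upper bound `⊤`.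
  have htop : U = ⊤ := by
    refine eq_top_of_mk_subcomodι_eq_top hC hinv (top_le_iff.1 (hlub.2 fun P hP => ?_))
    exact Subobject.le_mk_of_comm (subcomodLift hC hinv P.arrow fun x =>
      (hU _).2 ⟨P, hP, LinearMap.mem_range_self _ x⟩) (Comod.Hom.ext (LinearMap.ext fun x => rfl))
  obtain ⟨P, hP, hFP⟩ : ∃ P ∈ s, (F : Set M) ⊆ r P := by
    clear hF
    classical
    induction F using Finset.induction_on with
    | empty =>
      obtain ⟨P, hP⟩ := hne
      exact ⟨P, hP, by simp⟩
    | insert a F _ ih =>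
      obtain ⟨P, hP, h⟩ := ih
      obtain ⟨Q, hQ, h'⟩ := (hU a).1 (htop ▸ Submodule.mem_top)
      obtain ⟨T, hT, h1, h2⟩ := hdir P hP Q hQ
      refine ⟨T, hT, ?_⟩
      rw [Finset.coe_insert, Set.insert_subset_iff]
      exact ⟨hr _ _ h2 h', h.trans (hr _ _ h1)⟩
  have : P = ⊤ := subobject_eq_top_of_surjective hC P
    (LinearMap.range_eq_top.1 (hF _ (isInvariant_range P.arrow) hFP))
  rwa [← this]

/-- The subcomodules generated by finite subsets form a directed family with supremum `M`, so one of
them equals `M`. -/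
theorem exists_finset_generates (hC : IsWeaklyLocallyProjective (ModuleCat.of A C))
    {M : Comod A C} (hM : IsFinGenObj M) : ∃ F : Finset M, Generates (F : Set M) := by
  classical
  let g : Finset M → Subobject M := fun F =>
    Subobject.mk (subcomodι hC (isInvariant_generated (F : Set M)))
  have hg : Monotone g := fun F G hFG =>
    Subobject.mk_le_mk_of_comm (subcomodLift hC (isInvariant_generated (G : Set M))
      (subcomodι hC (isInvariant_generated (F : Set M))) fun x =>
        generated_le (isInvariant_generated (G : Set M))
          ((Finset.coe_subset.2 hFG).trans (subset_generated _)) x.2)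
      (Comod.Hom.ext (LinearMap.ext fun x => rfl))
  have hlub : IsLUB (Set.range g) ⊤ := by
    refine ⟨fun _ _ => le_top, fun P hP => top_le_iff.2 ?_⟩
    refine subobject_eq_top_of_surjective hC P fun x => ?_
    have hx : g {x} ≤ P := hP ⟨{x}, rfl⟩
    refine ⟨(Subobject.ofMkLE _ P hx).toLin ⟨x, subset_generated _ (by simp)⟩, ?_⟩
    exact Comod.hom_congr (Subobject.ofMkLE_arrow hx) _
  have hdir : DirectedOn (· ≤ ·) (Set.range g) := by
    rintro _ ⟨F, rfl⟩ _ ⟨G, rfl⟩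
    exact ⟨g (F ∪ G), ⟨_, rfl⟩, hg Finset.subset_union_left, hg Finset.subset_union_right⟩
  obtain ⟨F, hF⟩ := hM _ (Set.range_nonempty g) hdir hlub
  refine ⟨F, fun K hK h => top_le_iff.1 ?_⟩
  rw [← eq_top_of_mk_subcomodι_eq_top hC _ hF]
  exact generated_le hK h

theorem isFinGenObj_subcomod_generated (hC : IsWeaklyLocallyProjective (ModuleCat.of A C))
    {M : Comod A C} (F : Finset M) :
    IsFinGenObj (subcomod hC (isInvariant_generated (F : Set M))) := by
  classical
  let ι := subcomodι hC (isInvariant_generated (F : Set M))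
  refine isFinGenObj_of_generates hC (F.preimage ι.toLin (Subtype.val_injective.injOn))
    fun K hK h => top_le_iff.1 fun x _ => ?_
  -- Seen inside `M`, `K` is a subcomodule containing `F`, hence contains the subcomodule generated
  -- by `F`.
  have hK' : IsInvariant (K.map ι.toLin) := by
    rintro _ ⟨y, hy, rfl⟩ f
    exact ⟨_, hK y hy f, Comod.Hom.map_dualAct ι y f⟩
  obtain ⟨y, hy, hyx⟩ := generated_le hK' (fun y hy =>
    ⟨⟨y, subset_generated _ hy⟩, h (Finset.mem_coe.2 (Finset.mem_preimage.2 hy)), rfl⟩) x.2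
  rwa [← Subtype.val_injective hyx]

end Category

/-! ### `Q` as colinear maps into the rational part -/

section MoritaMaps

variable {A : Type u} [Ring A] {C : Type u} [AddCommGroup C] [Module A C] [Module Aᵐᵒᵖ C]
  [SMulCommClass A Aᵐᵒᵖ C] [Coring A C]

theorem balLift_mk {R M N P : Type*} [AddCommGroup M] [AddCommGroup N] [AddCommGroup P]
    (ρ : M → R → M) (l : R → N → N) (f : M →+ N →+ P)
    (hf : ∀ m r n, f (ρ m r) n = f m (l r n)) (m : M) (n : N) :
    balLift ρ l f hf (QuotientAddGroup.mk' (balancedRel ρ l) (m ⊗ₜ[ℤ] n)) = f m n :=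
  TensorProduct.liftAddHom_tmul (R := ℤ) f (fun k m n => by simp) m n

theorem balLift_induction {R M N P : Type*} [AddCommGroup M] [AddCommGroup N] [AddCommGroup P]
    (ρ : M → R → M) (l : R → N → N) (f : M →+ N →+ P)
    (hf : ∀ m r n, f (ρ m r) n = f m (l r n)) {p : P → Prop} (h0 : p 0)
    (h1 : ∀ m n, p (f m n)) (h2 : ∀ a b, p a → p b → p (a + b)) (t : BalTensor ρ l) :
    p (balLift ρ l f hf t) := by
  obtain ⟨z, rfl⟩ := QuotientAddGroup.mk'_surjective _ t
  induction z using TensorProduct.induction_on with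
  | zero => rwa [map_zero, map_zero]
  | tmul m n => rw [balLift_mk]; exact h1 m n
  | add x y hx hy => rw [map_add, map_add]; exact h2 _ _ hx hy

/-- Applying `f` to the equation defining `Q` gives `*C`-linearity of `q`. The converse,
`mem_comodQ`, holds because `*C` separates the points of `C`. -/
theorem comodQ_map_dualAct {S : Comod A C} (q : comodQ S) (x : S) (f : LeftDual A C) :
    q.1 (dualAct S x f) = conv (q.1 x) f :=
  LinearMap.ext fun c => (map_contract (evalAt q.1 c) f (S.str.coact x)).trans
    (congrArg f (q.2 x c))

theorem mem_comodQ (hC : IsWeaklyLocallyProjective (ModuleCat.of A C)) {S : Comod A C}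
    {φ : S →ₗ[Aᵐᵒᵖ] LeftDual A C} (h : ∀ x f, φ (dualAct S x f) = conv (φ x) f) :
    φ ∈ comodQ S := fun x c => ext_dual hC fun f =>
  (map_contract (evalAt φ c) f (S.str.coact x)).symm.trans (LinearMap.congr_fun (h x f) c)

theorem comodQ_apply_mem_ratDual (hC : IsWeaklyLocallyProjective (ModuleCat.of A C))
    {S : Comod A C} (q : comodQ S) (x : S) : q.1 x ∈ ratDual A C := by
  rw [ratDual_eq hC]
  exact ⟨rTensor C q.1 (S.str.coact x), fun f => by
    rw [contract_rTensor]; exact comodQ_map_dualAct q x f⟩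

/-- A colinear map to `Rat(*C)` as an element of `Q`. -/
noncomputable def comodQOfHom (hC : IsWeaklyLocallyProjective (ModuleCat.of A C)) {S : Comod A C}
    (φ : S ⟶ ratComod hC) : comodQ S :=
  ⟨(ratDual A C).subtype.comp φ.toLin, mem_comodQ hC fun x f =>
    (congrArg (ratDual A C).subtype (Comod.Hom.map_dualAct φ x f)).trans
      (dualAct_ratComod hC (φ.toLin x) f)⟩

/-- The colinear map `x ↦ m · q(x)` attached to an element `m` of a comodule and `q ∈ Q`. -/
def homOfComodQ (hC : IsWeaklyLocallyProjective (ModuleCat.of A C)) {S : Comod A C}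
    (q : comodQ S) {M : Comod A C} (m : M) : S ⟶ M :=
  Comod.Hom.ofDualAct hC
    { toFun x := dualAct M m (q.1 x)
      map_add' x y := by rw [map_add]; exact dualAct_add_fun M m _ _
      map_smul' a x := by rw [map_smul]; exact contract_op_smul_fun _ _ _ }
    fun x f => by
      change dualAct M m (q.1 (dualAct S x f)) = dualAct M (dualAct M m (q.1 x)) f
      rw [comodQ_map_dualAct, dualAct_dualAct]

theorem comodEnd_map_dualAct {S : Comod A C} (t : comodEnd S) (x : S) (f : LeftDual A C) :
    t.1 (dualAct S x f) = dualAct S (t.1 x) f :=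
  Comod.Hom.map_dualAct (⟨t.1, t.2⟩ : Comod.Hom S S) x f

theorem mul_tri {S : Comod A C} (t : comodEnd S) (x : S) (q : comodQ S) :
    t * tri x q = tri (t.1 x) q :=
  Subtype.ext (LinearMap.ext fun y => comodEnd_map_dualAct t x (q.1 y))

theorem restrictedTri_induction {S : Comod A C} {p : comodEnd S → Prop} (h0 : p 0)
    (h1 : ∀ x q, p (tri x q)) (h2 : ∀ a b, p a → p b → p (a + b)) {t : comodEnd S}
    (ht : t ∈ Set.range (restrictedTri S)) : p t := by
  obtain ⟨z, rfl⟩ := ht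
  exact balLift_induction _ _ _ _ h0 h1 h2 z

theorem tri_mem_range {S : Comod A C} (x : S) (q : comodQ S) :
    tri x q ∈ Set.range (restrictedTri S) :=
  ⟨_, balLift_mk _ _ (triHom S) _ x q⟩

theorem restrictedBtri_induction {S : Comod A C} {R : NonUnitalSubring (comodEnd S)}
    {p : LeftDual A C → Prop} (h0 : p 0) (h1 : ∀ (q : comodQ S) x, p (q.1 x))
    (h2 : ∀ a b, p a → p b → p (a + b)) {f : LeftDual A C}
    (hf : f ∈ Set.range (restrictedBtri S R)) : p f := by
  obtain ⟨z, rfl⟩ := hf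
  exact balLift_induction _ _ _ _ h0 h1 h2 z

theorem btri_mem_range {S : Comod A C} (R : NonUnitalSubring (comodEnd S)) (q : comodQ S) (x : S) :
    q.1 x ∈ Set.range (restrictedBtri S R) :=
  ⟨_, balLift_mk _ _ (btriHom S) _ q x⟩

end MoritaMaps

/-! ### From surjective Morita maps to a weakly locally projective generator -/

section MoritaToProjective

open CategoryTheory

variable {A : Type u} [Ring A] {C : Type u} [AddCommGroup C] [Module A C] [Module Aᵐᵒᵖ C]
  [SMulCommClass A Aᵐᵒᵖ C] [Coring A C]

/-- Write `m = m · r` with `r` a sum of values `q(x)`. Each `m · q(x)` is the value at `x` of a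
colinear map `Σ → M`, and on such values the two maps agree. -/
theorem isSeparator_of_restrictedBtri (hC : IsWeaklyLocallyProjective (ModuleCat.of A C))
    (hdense : @Dense (LeftDual A C) (finiteTopology A C) (ratDual A C)) {S : Comod A C}
    {R : NonUnitalSubring (comodEnd S)}
    (hR : (ratDual A C : Set (LeftDual A C)) ⊆ Set.range (restrictedBtri S R)) :
    IsSeparator S := by
  rw [isSeparator_def]
  refine fun M N φ ψ h => Comod.Hom.ext (LinearMap.ext fun m => ?_)
  obtain ⟨r, hr, hrm⟩ := exists_ratDual_dualAct_eq hdense M m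
  rw [← hrm]
  refine restrictedBtri_induction (p := fun r => φ.toLin (dualAct M m r) = ψ.toLin (dualAct M m r))
    ?_ (fun q x => ?_) (fun f g hf hg => ?_) (hR hr)
  · rw [show dualAct M m 0 = 0 from map_zero (dualActHom M m), map_zero, map_zero]
  · exact Comod.hom_congr (h (homOfComodQ hC q m)) x
  · rw [dualAct_add_fun, map_add, map_add, hf, hg]

/-- For `e = y ◁ q`, choose `m` over `f(y)`; then `x ↦ m · q(x)` lifts `f ∘ e`. Sums of such `e` are
handled by adding lifts. -/
theorem exists_lift_of_mem_range_restrictedTri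
    (hC : IsWeaklyLocallyProjective (ModuleCat.of A C)) {S M N : Comod A C} (f : S ⟶ N)
    (g : M ⟶ N) [Epi g] {e : comodEnd S} (he : e ∈ Set.range (restrictedTri S)) :
    ∃ h : S ⟶ M, ∀ x, g.toLin (h.toLin x) = f.toLin (e.1 x) := by
  refine restrictedTri_induction
    (p := fun e => ∃ h : S ⟶ M, ∀ x, g.toLin (h.toLin x) = f.toLin (e.1 x)) ?_ ?_ ?_ he
  · exact ⟨Comod.Hom.zero hC S M, fun x => (map_zero g.toLin).trans (map_zero f.toLin).symm⟩
  · intro y q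
    obtain ⟨m, hm⟩ := Comod.surjective_of_epi hC g (f.toLin y)
    refine ⟨homOfComodQ hC q m, fun x => ?_⟩
    change g.toLin (dualAct M m (q.1 x)) = f.toLin (dualAct S y (q.1 x))
    rw [Comod.Hom.map_dualAct, Comod.Hom.map_dualAct, hm]
  · rintro a b ⟨h, hh⟩ ⟨k, hk⟩
    refine ⟨Comod.Hom.add hC h k, fun x => ?_⟩
    change g.toLin (h.toLin x + k.toLin x) = f.toLin (a.1 x + b.1 x)
    rw [map_add, map_add, hh, hk]

theorem isWeaklyLocallyProjective_of_restrictedTri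
    (hC : IsWeaklyLocallyProjective (ModuleCat.of A C)) {S : Comod A C}
    {R : NonUnitalSubring (comodEnd S)} (hR : ActsWithLocalUnits R)
    (hR' : (R : Set (comodEnd S)) ⊆ Set.range (restrictedTri S)) :
    IsWeaklyLocallyProjective S := by
  classical
  intro E M N i f g _ _ hE
  obtain ⟨F, hF⟩ := exists_finset_generates hC hE
  obtain ⟨e, heR, he⟩ := hR (F.image i.toLin)
  obtain ⟨h, hh⟩ := exists_lift_of_mem_range_restrictedTri hC f g (hR' heR)
  refine ⟨h, ?_⟩
  -- The equalizer is a subcomodule of `E`, so agreement on the generators `F` suffices; there `e`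
  -- acts as the identity.
  have hinv : IsInvariant (LinearMap.eqLocus (i ≫ h ≫ g).toLin (i ≫ f).toLin) := fun x hx k => by
    rw [LinearMap.mem_eqLocus] at hx ⊢
    rw [Comod.Hom.map_dualAct, Comod.Hom.map_dualAct, hx]
  have htop := hF _ hinv fun x hx => by
    change g.toLin (h.toLin (i.toLin x)) = f.toLin (i.toLin x)
    rw [hh, he _ (Finset.mem_image_of_mem _ hx)]
  exact Comod.Hom.ext (LinearMap.ext fun x =>
    LinearMap.mem_eqLocus.1 (htop ▸ Submodule.mem_top : x ∈ LinearMap.eqLocus _ _))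

end MoritaToProjective

/-! ### From a weakly locally projective generator to surjective Morita maps -/

section ProjectiveToMorita

open CategoryTheory

variable {A : Type u} [Ring A] {C : Type u} [AddCommGroup C] [Module A C] [Module Aᵐᵒᵖ C]
  [SMulCommClass A Aᵐᵒᵖ C] [Coring A C]

/-- On generators, `(x ◁ q) b = x ◁ (q b)`. -/
theorem mul_mem_range_restrictedTri {S : Comod A C} {a : comodEnd S}
    (ha : a ∈ Set.range (restrictedTri S)) (b : comodEnd S) :
    a * b ∈ Set.range (restrictedTri S) := by
  refine restrictedTri_induction (p := fun a => a * b ∈ (restrictedTri S).range) ?_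
    (fun x q => tri_mem_range x (actQT q b)) (fun a c ha hc => ?_) ha
  · rw [zero_mul]; exact zero_mem _
  · rw [add_mul]; exact add_mem ha hc

variable (A C) in
/-- The image of `Σ ⊗ Q → T` as a nonunital subring. -/
def triRange (S : Comod A C) : NonUnitalSubring (comodEnd S) :=
  { (restrictedTri S).range with
    mul_mem' := fun {_ b} ha _ => mul_mem_range_restrictedTri ha b }

theorem exists_finset_mul_eq {S : Comod A C} {r : comodEnd S}
    (hr : r ∈ Set.range (restrictedTri S)) :
    ∃ F : Finset S, ∀ e : comodEnd S, (∀ x ∈ F, e.1 x = x) → e * r = r := by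
  classical
  refine restrictedTri_induction
    (p := fun r => ∃ F : Finset S, ∀ e : comodEnd S, (∀ x ∈ F, e.1 x = x) → e * r = r)
    ⟨∅, fun e _ => mul_zero e⟩ (fun x q => ⟨{x}, fun e he => ?_⟩) ?_ hr
  · rw [mul_tri, he x (Finset.mem_singleton_self x)]
  · rintro a b ⟨F, hF⟩ ⟨G, hG⟩
    exact ⟨F ∪ G, fun e he => by
      rw [mul_add, hF e fun x hx => he x (Finset.mem_union_left _ hx),
        hG e fun x hx => he x (Finset.mem_union_right _ hx)]⟩

/-- Since `e (x ◁ q) = e(x) ◁ q`, an `e` fixing the finitely many `x` that occur in given elements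
of the image is a left unit for them. -/
theorem hasLeftLocalUnits_of_actsWithLocalUnits {S : Comod A C}
    (h : ActsWithLocalUnits (triRange A C S)) : HasLeftLocalUnits (triRange A C S) := by
  classical
  intro F
  choose G hG using fun r : triRange A C S => exists_finset_mul_eq r.2
  obtain ⟨e, he, hex⟩ := h (F.biUnion G)
  exact ⟨⟨e, he⟩, fun r hr => Subtype.ext (hG r e fun x hx =>
    hex x (Finset.mem_biUnion.2 ⟨r, hr, hx⟩))⟩

/-- `r ↦ x · r` as a colinear map on `Rat(*C)`. -/
noncomputable def ratAct (hC : IsWeaklyLocallyProjective (ModuleCat.of A C)) (S : Comod A C)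
    (x : S) : ratComod hC ⟶ S :=
  Comod.Hom.ofDualAct hC
    ({ toFun r := dualAct S x r.1
       map_add' _ _ := dualAct_add_fun S x _ _
       map_smul' _ _ := contract_op_smul_fun _ _ _ } : ratDual A C →ₗ[Aᵐᵒᵖ] S)
    fun r f => (congrArg (dualAct S x) (dualAct_ratComod hC r f)).trans
      (dualAct_dualAct S x _ f).symm

/-- The colinear map `Rat(*C)^(Σ) → Σ` with components `r ↦ x · r`. -/
noncomputable def ratCover (hC : IsWeaklyLocallyProjective (ModuleCat.of A C)) (S : Comod A C) :
    finsuppComod hC S (ratComod hC) ⟶ S :=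
  finsuppComodLift hC (ratAct hC S)

theorem ratCover_epi (hC : IsWeaklyLocallyProjective (ModuleCat.of A C))
    (hdense : @Dense (LeftDual A C) (finiteTopology A C) (ratDual A C)) (S : Comod A C) :
    Epi (ratCover hC S) := by
  classical
  refine Comod.epi_of_surjective _ fun x => ?_
  obtain ⟨r, hr, hx⟩ := exists_ratDual_dualAct_eq hdense S x
  let r' : ratComod hC := (⟨r, hr⟩ : ratDual A C)
  exact ⟨Finsupp.single x r',
    (Finsupp.lsum_single ℕ (fun y => (ratAct hC S y).toLin) x r').trans hx⟩

theorem actsWithLocalUnits_triRange (hC : IsWeaklyLocallyProjective (ModuleCat.of A C))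
    (hdense : @Dense (LeftDual A C) (finiteTopology A C) (ratDual A C)) {S : Comod A C}
    (hS : IsWeaklyLocallyProjective S) : ActsWithLocalUnits (triRange A C S) := by
  classical
  intro F
  have := ratCover_epi hC hdense S
  obtain ⟨h, hh⟩ := hS _ _ _ (subcomodι hC (isInvariant_generated (F : Set S)))
    (𝟙 S) (ratCover hC S) inferInstance this (isFinGenObj_subcomod_generated hC F)
  let hl : S →ₗ[Aᵐᵒᵖ] (S →₀ ratComod hC) := h.toLin
  have hl_act : ∀ x f, hl (dualAct S x f) =
      (hl x).mapRange (fun m => dualAct (ratComod hC) m f) (dualAct_zero _ f) := fun x f =>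
    (Comod.Hom.map_dualAct h x f).trans (dualAct_finsuppComod hC S (ratComod hC) (hl x) f)
  -- The component of the lift at `y` is a colinear map `Σ → Rat(*C)`, hence an element of `Q`.
  let q : S → comodQ S := fun y => comodQOfHom hC
    (Comod.Hom.ofDualAct hC ((Finsupp.lapply y).comp hl) fun x f => by
      simp [hl_act])
  let s : Finset S := F.biUnion fun x => (hl x).support
  refine ⟨∑ y ∈ s, tri y (q y), sum_mem fun y _ => tri_mem_range y (q y), fun x hx => ?_⟩
  -- On `F`, covering after lifting is the identity; written out, `x = ∑ y · q_y(x)`, which is the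
  -- value at `x` of `∑ y ◁ q_y`.
  have hx' : Finsupp.lsum ℕ (fun y => (ratAct hC S y).toLin) (hl x) = x :=
    Comod.hom_congr hh ⟨x, subset_generated _ hx⟩
  rw [Finsupp.lsum_apply, Finsupp.sum_of_support_subset _
    (Finset.subset_biUnion_of_mem (fun x => (hl x).support) hx) _ (by simp)] at hx'
  conv_rhs => rw [← hx']
  rw [AddSubmonoidClass.coe_finsetSum, LinearMap.sum_apply]
  rfl

theorem conv_mem_range_restrictedBtri {S : Comod A C} {R : NonUnitalSubring (comodEnd S)}
    {r : LeftDual A C} (hr : r ∈ (restrictedBtri S R).range) (f : LeftDual A C) :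
    conv r f ∈ (restrictedBtri S R).range := by
  refine restrictedBtri_induction (p := fun r => conv r f ∈ (restrictedBtri S R).range) ?_
    (fun q x => ?_) (fun a b ha hb => ?_) hr
  · have h := conv_add (0 : LeftDual A C) 0 f
    rw [add_zero, left_eq_add] at h
    rw [h]
    exact zero_mem _
  · rw [← comodQ_map_dualAct]
    exact btri_mem_range R q _
  · rw [conv_add]
    exact add_mem ha hb

/-- The image of `Q ⊗_R Σ → *C` as an `A`-submodule. -/
def btriRange (S : Comod A C) (R : NonUnitalSubring (comodEnd S)) :
    Submodule Aᵐᵒᵖ (LeftDual A C) where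
  carrier := (restrictedBtri S R).range
  add_mem' := (restrictedBtri S R).range.add_mem
  zero_mem' := (restrictedBtri S R).range.zero_mem
  smul_mem' a r hr := by
    rw [← conv_smul_counit]
    exact conv_mem_range_restrictedBtri hr _

theorem range_restrictedBtri_eq (hC : IsWeaklyLocallyProjective (ModuleCat.of A C))
    {S : Comod A C} (hS : IsSeparator S) (R : NonUnitalSubring (comodEnd S)) :
    Set.range (restrictedBtri S R) = ratDual A C := by
  refine Set.Subset.antisymm (fun r hr => restrictedBtri_induction
    (p := fun r => r ∈ ratDual A C) (zero_mem _) (comodQ_apply_mem_ratDual hC)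
    (fun _ _ => add_mem) hr) fun r hr => ?_
  let K : Submodule Aᵐᵒᵖ (ratComod hC) := (btriRange S R).comap (ratDual A C).subtype
  have hK : IsInvariant K := fun x hx f => by
    change Subtype.val (dualAct (ratComod hC) x f) ∈ btriRange S R
    exact (dualAct_ratComod hC x f).symm ▸ conv_mem_range_restrictedBtri hx f
  -- Every colinear map `Σ → Rat(*C)` comes from `Q`, so its values lie in `K` and the projection
  -- kills it; a separator then forces the projection to vanish.
  have h : quotComodπ hC hK = Comod.Hom.zero hC _ _ :=
    (isSeparator_def S).1 hS _ _ fun φ => Comod.Hom.ext (LinearMap.ext fun x =>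
      (Submodule.Quotient.mk_eq_zero K).2 (btri_mem_range R (comodQOfHom hC φ) x))
  exact (Submodule.Quotient.mk_eq_zero K).1 (Comod.hom_congr h (⟨r, hr⟩ : ratDual A C))

end ProjectiveToMorita

end GaloisComodule

theorem theorem3p4 {A : Type u} [Ring A] {C : Type u} [AddCommGroup C] [Module A C]
    [Module Aᵐᵒᵖ C] [SMulCommClass A Aᵐᵒᵖ C] [GaloisComodule.Coring A C]
    (hC : GaloisComodule.IsWeaklyLocallyProjective (ModuleCat.of A C))
    (hdense : @Dense (GaloisComodule.LeftDual A C) (GaloisComodule.finiteTopology A C)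
      (GaloisComodule.ratDual A C))
    (S : GaloisComodule.Comod A C) :
    (GaloisComodule.IsWeaklyLocallyProjective S ∧ CategoryTheory.IsSeparator S) ↔
      ∃ R : NonUnitalSubring (GaloisComodule.comodEnd S),
        GaloisComodule.HasLeftLocalUnits R ∧
        GaloisComodule.IsRightIdeal R ∧
        GaloisComodule.ActsWithLocalUnits R ∧
        Set.range (GaloisComodule.restrictedTri S) = R ∧
        Set.range (GaloisComodule.restrictedBtri S R) = GaloisComodule.ratDual A C := by
  constructor
  · rintro ⟨hS, hgen⟩
    have h := GaloisComodule.actsWithLocalUnits_triRange hC hdense hS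
    exact ⟨GaloisComodule.triRange A C S,
      GaloisComodule.hasLeftLocalUnits_of_actsWithLocalUnits h,
      fun r hr t => GaloisComodule.mul_mem_range_restrictedTri hr t, h, rfl,
      GaloisComodule.range_restrictedBtri_eq hC hgen _⟩
  · rintro ⟨R, -, -, hact, htri, hbtri⟩
    exact ⟨GaloisComodule.isWeaklyLocallyProjective_of_restrictedTri hC hact htri.ge,
      GaloisComodule.isSeparator_of_restrictedBtri hC hdense hbtri.ge⟩
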